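/- Let $\{a_{k,n}\}_{1\le k\le n}$ be an array of positive real numbers with $\sup_n\max_{1\le k\le n}a_{k,n}<\infty$, let $\{\rho_n\}_{n\ge1}$ be a real sequence with $\rho_n\log n\to+\infty$, and let $\ell\in\mathbb R$. For a sequence $\{\alpha_k\}_{k\ge 1}$ of positive numbers, let $(W_\alpha)$ denote the assumptions $$\limsup_{n\to\infty}\frac{\sum_{k=1}^n\alpha_ka_{k,n}|\log(\alpha_ka_{k,n})|}{\rho_n\log n}<\infty,\qquad \lim_{n\to\infty}\frac{\sum_{k=1}^n\alpha_ka_{k,n}\log(\alpha_ka_{k,n})}{\rho_n\log n}=-\ell,\qquad \sup_n\sum_{k=1}^n\alpha_ka_{k,n}<\infty .$$ 1. (Engel series.) For $x\in(0,1]$ let $\{D_n(x)\}_{n\ge1}$ be the digits of its Engel series $x=\sum_{n\ge1}\frac{1}{D_1\cdots D_n}$, that is, $x_1=x$, $D_n=\lfloor 1/x_n\rfloor+1$, $x_{n+1}=D_nx_n-1$. If $(W_\alpha)$ holds with $\alpha_k\equiv1$, then $$\frac{1}{\rho_n\log n}\sum_{k=1}^na_{k,n}\frac{D_{k+1}}{D_k}\longrightarrow\ell\qquad(n\to\infty)$$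 in probability with respect to Lebesgue measure on $[0,1]$. 2. (Engel scheme with general distribution functions.) Let $\{F_n\}_{n\ge1}$ be probability distribution functions on $[0,1]$ with $F_n(0)=0$, and let $\alpha_n>0$ satisfy $0<\liminf\alpha_n\le\limsup\alpha_n<\infty$, $$\lim_{t\to0^+}\sup_n\Big|\frac{F_n(t)}{t}-\alpha_n\Big|=0,\qquad \lim_{t\to0^+}\sup_n\int_0^t\frac1u\Big|\frac{F_n(u)}{u}-\alpha_n\Big|\,du=0,$$ and $(W_\alpha)$. Let $\{D_n\}_{n\ge1}$ be integer-valued random variables on a probability space $(\Omega,P)$ such that $\Theta_n=D_n-1\ge1$ almost surely and, for all $n\ge1$ and all positive integers $h_1\le\dots\le h_n$ and $h_{n+1}\geq 1$ with $P(\Theta_1=h_1,\dots,\Theta_n=h_n)>0$, $$P(\Theta_{n+1}=h_{n+1}\mid\Theta_n=h_n,\dots,\Theta_1=h_1)=F_n\Big(\frac{h_n}{h_{n+1}}\Big)-F_n\Big(\frac{h_n}{h_{n+1}+1}\Big),$$ where $F_n=1$ on $[1,\infty)$. Then $\frac{1}{\rho_n\log n}\sum_{k=1}^na_{k,n}\frac{D_{k+1}}{D_k}\to\ell$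 in probability. -/

import Mathlib

open MeasureTheory ProbabilityTheory Filter Topology
open scoped ENNReal

/-- Remainders of the Engel series algorithm: `x₁ = x`, `xₙ₊₁ = dₙ xₙ - 1` with
`dₙ = ⌊1 / xₙ⌋ + 1`, that is `1 / dₙ < xₙ ≤ 1 / (dₙ - 1)`. The value at index `n` is `xₙ₊₁`. -/
noncomputable def engelRemainder (x : ℝ) : ℕ → ℝ
  | 0 => x
  | n + 1 => ((⌊1 / engelRemainder x n⌋₊ + 1 : ℕ) : ℝ) * engelRemainder x n - 1

/-- The `n`-th digit `Dₙ(x)`, `n ≥ 1`, of the Engel series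
`x = 1 / D₁ + 1 / (D₁ D₂) + 1 / (D₁ D₂ D₃) + ⋯` of `x ∈ (0, 1]`. -/
noncomputable def engelDigit (n : ℕ) (x : ℝ) : ℕ :=
  ⌊1 / engelRemainder x (n - 1)⌋₊ + 1

/-- `F` is a distribution function on `[0, 1]` with `F 0 = 0`
(a `StieltjesFunction` is monotone and right-continuous). -/
structure IsUnitDistribution (F : StieltjesFunction ℝ) : Prop where
  eq_zero : ∀ t ≤ 0, F t = 0
  eq_one : ∀ t, 1 ≤ t → F t = 1

/-- Condition (i): `αₙ > 0`, `0 < liminf αₙ ≤ limsup αₙ < ∞` and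
`sup_{n ≥ 1} |Fₙ(t) / t - αₙ| → 0` as `t → 0+`. -/
structure ConditionI (F : ℕ → StieltjesFunction ℝ) (α : ℕ → ℝ) : Prop where
  pos : ∀ n, 1 ≤ n → 0 < α n
  liminf_pos : 0 < liminf (fun n => (α n : EReal)) atTop
  limsup_lt_top : limsup (fun n => (α n : EReal)) atTop < ⊤
  tendsto_sup :
    Tendsto (fun t : ℝ => ⨆ n : ℕ, ⨆ _ : 1 ≤ n, ENNReal.ofReal |F n t / t - α n|)
      (𝓝[>] 0) (𝓝 0)

/-- Condition (ii): `sup_{n ≥ 1} ∫₀ᵗ (1 / u) |Fₙ(u) / u - αₙ| du → 0` as `t → 0+`. -/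
def ConditionII (F : ℕ → StieltjesFunction ℝ) (α : ℕ → ℝ) : Prop :=
  Tendsto (fun t : ℝ => ⨆ n : ℕ, ⨆ _ : 1 ≤ n,
      ∫⁻ u in Set.Ioo 0 t, ENNReal.ofReal (1 / u * |F n u / u - α n|))
    (𝓝[>] 0) (𝓝 0)

/-- The assumptions on the array `a k n` (`1 ≤ k ≤ n`), the normalisation `ρ` and the limit `ℓ`,
relative to the constants `α`. -/
structure WeightAssumptions (α : ℕ → ℝ) (a : ℕ → ℕ → ℝ) (ρ : ℕ → ℝ) (ℓ : ℝ) : Prop where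
  pos : ∀ n k, 1 ≤ k → k ≤ n → 0 < a k n
  tendsto_norm : Tendsto (fun n : ℕ => ρ n * Real.log n) atTop atTop
  limsup_lt_top :
    limsup (fun n : ℕ =>
      (((∑ k ∈ Finset.Icc 1 n, α k * a k n * |Real.log (α k * a k n)|)
        / (ρ n * Real.log n) : ℝ) : EReal)) atTop < ⊤
  tendsto_entropy :
    Tendsto (fun n : ℕ =>
      (∑ k ∈ Finset.Icc 1 n, α k * a k n * Real.log (α k * a k n)) / (ρ n * Real.log n))
      atTop (𝓝 (-ℓ))
  bounded : ∃ S : ℝ, ∀ n, 1 ≤ n → |∑ k ∈ Finset.Icc 1 n, α k * a k n| ≤ S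

/-- `δⱼ(h, k, q) = φⱼ(h) (1 + q) / (k + φⱼ(h) q)`. -/
noncomputable def oppenheimDelta (φ : ℕ → ℕ → ℝ) (j h k : ℕ) (q : ℝ) : ℝ :=
  φ j h * (1 + q) / (k + φ j h * q)

/-- `(Θₙ)_{n ≥ 1}` is a sequence of positive-integer valued random variables following the
Oppenheim scheme with distribution functions `Fₙ` and functions `φₙ`, `qₙ(h₁, …, hₙ)`:
`P(Θₙ₊₁ = hₙ₊₁ | Θₙ = hₙ, …, Θ₁ = h₁) = Fₙ(δₙ(hₙ, hₙ₊₁, qₙ)) - Fₙ(δₙ(hₙ, hₙ₊₁ + 1, qₙ))`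
for all admissible `h₁, …, hₙ` for which the conditioning event is not null. -/
structure IsOppenheimSequence {Ω : Type*} [MeasurableSpace Ω] (P : Measure Ω)
    (F : ℕ → StieltjesFunction ℝ) (φ : ℕ → ℕ → ℝ) (q : (n : ℕ) → (Fin n → ℕ) → ℝ)
    (Θ : ℕ → Ω → ℕ) : Prop where
  measurable : ∀ n, 1 ≤ n → Measurable (Θ n)
  pos : ∀ n, 1 ≤ n → ∀ᵐ ω ∂P, 1 ≤ Θ n ω
  cond_law : ∀ n, 1 ≤ n → ∀ h : ℕ → ℕ, 1 ≤ h 1 → 1 ≤ h (n + 1) →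
    (∀ j, 2 ≤ j → j ≤ n → φ (j - 1) (h (j - 1)) ≤ h j) →
    P {ω | ∀ j, 1 ≤ j → j ≤ n → Θ j ω = h j} ≠ 0 →
    P[{ω | Θ (n + 1) ω = h (n + 1)} | {ω | ∀ j, 1 ≤ j → j ≤ n → Θ j ω = h j}] =
      ENNReal.ofReal
        (F n (oppenheimDelta φ n (h n) (h (n + 1)) (q n fun i => h ((i : ℕ) + 1)))
          - F n (oppenheimDelta φ n (h n) (h (n + 1) + 1) (q n fun i => h ((i : ℕ) + 1))))

/-- `(Dₙ)_{n ≥ 1}` is an Engel sequence with distribution functions `Fₙ`: `Θₙ = Dₙ - 1 ≥ 1`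
follows the Oppenheim scheme with `φₙ(h) = h` and `qₙ = 0`, so that the associated ratio
`Rₙ = 1 / δₙ(Θₙ, Θₙ₊₁, 0)` is `(Dₙ₊₁ - 1) / (Dₙ - 1)`. -/
def IsEngelSequence {Ω : Type*} [MeasurableSpace Ω] (P : Measure Ω)
    (F : ℕ → StieltjesFunction ℝ) (D : ℕ → Ω → ℕ) : Prop :=
  IsOppenheimSequence P F (fun _ h => (h : ℝ)) (fun _ _ => 0) (fun n ω => D n ω - 1)

/-! Write Θₙ = Dₙ - 1 and c = ρₙ log n. Given the past, Θₖ₊₁ has the law of ⌊Θₖ / U⌋ with U ∼ Fₖ, so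
Dₖ₊₁ / Dₖ is close to 1 / U once Θₖ is large. Since Fₖ(t) ~ αₖ t near 0, the variable 1 / U has no
mean, and the weak law has to come from truncation: with w = a / c, each term w Dₖ₊₁ / Dₖ is cut at
1.

The cut term lies between (1 - 1 / Dₖ) w / max(U, w) and w / max(U, w). As Fₖ(t) ≤ C t, its
conditional second moment is at most (1 + 2C) w. Hence the probability that some cut is active and
the variance of the sum of conditionally centred terms are both O(∑ w), which vanishes because ∑ a
is bounded and c → ∞. Replacing the conditional means by w E[1 / max(U, w)] costs a factor 1 / Dₖ,
whose expectation decays geometrically because Θ at least doubles with probability bounded below.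
`measureReal_sum_ratio_sub_ge_le` combines these three errors.

The centring is explicit: E[1 / max(U, w)] = 1 + ∫_w^1 F(v) / v² dv = α log(1 / w) + O(1), by
condition (ii). Summed against w this gives (∑ α a) log c / c - (∑ α a log a) / c + o(1), which
tends to ℓ (`tendsto_truncated_means`).

For the Engel series, the remainder given the first n digits is uniform on (0, 1 / Θₙ]
(`exists_volume_engel_cylinder`), so the digits follow the scheme with all Fₙ uniform and αₙ = 1. -/

namespace IsUnitDistribution

variable {F : StieltjesFunction ℝ}

/-! ### Moments of `1 / max U s` in terms of the distribution function. -/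

theorem tendsto_atBot (hF : IsUnitDistribution F) : Tendsto F atBot (𝓝 0) :=
  tendsto_const_nhds.congr' ((eventually_le_atBot 0).mono fun t ht => (hF.eq_zero t ht).symm)

theorem tendsto_atTop (hF : IsUnitDistribution F) : Tendsto F atTop (𝓝 1) :=
  tendsto_const_nhds.congr' ((eventually_ge_atTop 1).mono fun t ht => (hF.eq_one t ht).symm)

theorem isProbabilityMeasure (hF : IsUnitDistribution F) : IsProbabilityMeasure F.measure :=
  F.isProbabilityMeasure hF.tendsto_atBot hF.tendsto_atTop

theorem nonneg (hF : IsUnitDistribution F) (t : ℝ) : 0 ≤ F t := by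
  rcases le_total t 0 with h | h
  · exact (hF.eq_zero t h).ge
  · exact (hF.eq_zero 0 le_rfl).ge.trans (F.mono h)

theorem le_one (hF : IsUnitDistribution F) (t : ℝ) : F t ≤ 1 := by
  rcases le_total t 1 with h | h
  · exact (F.mono h).trans (hF.eq_one 1 le_rfl).le
  · exact (hF.eq_one t h).le

theorem measure_Iic (hF : IsUnitDistribution F) (t : ℝ) :
    F.measure (Set.Iic t) = ENNReal.ofReal (F t) := by
  rw [F.measure_Iic hF.tendsto_atBot, sub_zero]

theorem measureReal_Iic (hF : IsUnitDistribution F) (t : ℝ) :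
    F.measure.real (Set.Iic t) = F t := by
  rw [measureReal_def, hF.measure_Iic, ENNReal.toReal_ofReal (hF.nonneg t)]

theorem ae_mem (hF : IsUnitDistribution F) : ∀ᵐ u ∂F.measure, 0 < u ∧ u ≤ 1 := by
  have := hF.isProbabilityMeasure
  have h : F.measure (Set.Ioc 0 1) = 1 := by
    rw [F.measure_Ioc, hF.eq_one 1 le_rfl, hF.eq_zero 0 le_rfl]; simp
  exact (prob_compl_eq_zero_iff measurableSet_Ioc).2 h

/-- Tonelli's formula for the expectation of a function of `max U s`, where `U` has
distribution function `F`. -/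
theorem integral_comp_max (hF : IsUnitDistribution F) {G w : ℝ → ℝ} {s : ℝ} (hs1 : s ≤ 1)
    (hG : ∀ v ∈ Set.Icc s 1, HasDerivAt G (-w v) v) (hw : ContinuousOn w (Set.Icc s 1)) :
    ∫ u, G (max u s) ∂F.measure = G 1 + ∫ v in s..1, F v * w v := by
  have := hF.isProbabilityMeasure
  have hwi : Integrable w (volume.restrict (Set.Ioc s 1)) :=
    (hw.integrableOn_Icc).mono_set Set.Ioc_subset_Icc_self
  have hms : MeasurableSet {p : ℝ × ℝ | p.1 ≤ p.2} := measurableSet_le measurable_fst measurable_snd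
  have hint : Integrable ({p : ℝ × ℝ | p.1 ≤ p.2}.indicator fun p => w p.2)
      (F.measure.prod (volume.restrict (Set.Ioc s 1))) := (hwi.comp_snd F.measure).indicator hms
  have hpt : ∀ᵐ u ∂F.measure, G (max u s) = G 1 +
      ∫ v in Set.Ioc s 1, ({p : ℝ × ℝ | p.1 ≤ p.2}.indicator fun p => w p.2) (u, v) := by
    filter_upwards [hF.ae_mem] with u hu
    have hm : max u s ≤ 1 := max_le hu.2 hs1
    have hsub : Set.uIcc (max u s) 1 ⊆ Set.Icc s 1 := by
      rw [Set.uIcc_of_le hm]; exact Set.Icc_subset_Icc_left (le_max_right _ _)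
    have h1 : ∫ v in (max u s)..1, -w v = G 1 - G (max u s) :=
      intervalIntegral.integral_eq_sub_of_hasDerivAt (fun v hv => hG v (hsub hv))
        ((hw.mono hsub).neg.intervalIntegrable)
    rw [intervalIntegral.integral_neg, intervalIntegral.integral_of_le hm] at h1
    -- The two domains differ at most in the point `v = u`, which is Lebesgue-null.
    have h2 : ∫ v in Set.Ioc s 1, ({p : ℝ × ℝ | p.1 ≤ p.2}.indicator fun p => w p.2) (u, v)
        = ∫ v in Set.Ioc (max u s) 1, w v := by
      have : (fun v => ({p : ℝ × ℝ | p.1 ≤ p.2}.indicator fun p => w p.2) (u, v))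
          = (Set.Ici u).indicator w := by
        ext v; simp [Set.indicator]
      rw [this, setIntegral_indicator measurableSet_Ici, ← integral_indicator measurableSet_Ioc,
        ← integral_indicator (measurableSet_Ioc.inter measurableSet_Ici)]
      refine integral_congr_ae ?_
      filter_upwards [compl_mem_ae_iff.2 (measure_singleton (μ := (volume : Measure ℝ)) u)]
        with v hv
      have hv : v ≠ u := hv
      have : v ∈ Set.Ioc s 1 ∩ Set.Ici u ↔ v ∈ Set.Ioc (max u s) 1 := by
        simp only [Set.mem_inter_iff, Set.mem_Ioc, Set.mem_Ici, max_lt_iff]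
        constructor
        · rintro ⟨⟨h1, h2⟩, h3⟩; exact ⟨⟨lt_of_le_of_ne h3 hv.symm, h1⟩, h2⟩
        · rintro ⟨⟨h1, h2⟩, h3⟩; exact ⟨⟨h2, h3⟩, h1.le⟩
      by_cases h : v ∈ Set.Ioc (max u s) 1
      · rw [Set.indicator_of_mem h, Set.indicator_of_mem (this.2 h)]
      · rw [Set.indicator_of_notMem h, Set.indicator_of_notMem (fun h' => h (this.1 h'))]
    rw [h2]; linarith
  have hswap := integral_integral_swap
    (f := fun u v => ({p : ℝ × ℝ | p.1 ≤ p.2}.indicator fun p => w p.2) (u, v)) hint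
  rw [integral_congr_ae hpt, integral_add (integrable_const _) hint.integral_prod_left,
    integral_const, probReal_univ, one_smul, hswap,
    intervalIntegral.integral_of_le hs1]
  congr 1
  refine integral_congr_ae (Eventually.of_forall fun v => ?_)
  have : (fun u => ({p : ℝ × ℝ | p.1 ≤ p.2}.indicator fun p => w p.2) (u, v))
      = (Set.Iic v).indicator fun _ => w v := by
    ext u; simp [Set.indicator]
  simp only [this]
  rw [integral_indicator_const _ measurableSet_Iic, hF.measureReal_Iic, smul_eq_mul]

theorem integral_inv_max (hF : IsUnitDistribution F) {s : ℝ} (hs : 0 < s) (hs1 : s ≤ 1) :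
    ∫ u, (max u s)⁻¹ ∂F.measure = 1 + ∫ v in s..1, F v / v ^ 2 := by
  have h := hF.integral_comp_max (G := fun v => v⁻¹) (w := fun v => (v ^ 2)⁻¹) hs1
    (fun v hv => hasDerivAt_inv (hs.trans_le hv.1).ne')
    (ContinuousOn.inv₀ (by fun_prop) fun v hv => pow_ne_zero _ (hs.trans_le hv.1).ne')
  simpa [div_eq_mul_inv] using h

/-- Tonelli with `G v = v⁻²` gives 1 + ∫ 2 F(v) v⁻³ dv over (s, 1), and F(v) ≤ C v turns this into
at most 1 + 2C (s⁻¹ - 1). So the truncated second moment grows only like 1 / s. -/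
theorem integral_inv_max_sq_le (hF : IsUnitDistribution F) {s C : ℝ} (hs : 0 < s) (hs1 : s ≤ 1)
    (hC : ∀ t, 0 < t → F t ≤ C * t) :
    ∫ u, ((max u s)⁻¹) ^ 2 ∂F.measure ≤ (1 + 2 * C) * s⁻¹ := by
  have h0 : ∀ v ∈ Set.Icc s 1, v ≠ 0 := fun v hv => (hs.trans_le hv.1).ne'
  have hwc : ContinuousOn (fun v : ℝ => 2 * (v ^ 3)⁻¹) (Set.Icc s 1) :=
    continuousOn_const.mul (ContinuousOn.inv₀ (by fun_prop) fun v hv => pow_ne_zero _ (h0 v hv))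
  have h := hF.integral_comp_max (G := fun v => (v⁻¹) ^ 2) (w := fun v => 2 * (v ^ 3)⁻¹) hs1
    (fun v hv => by
      refine ((hasDerivAt_inv (h0 v hv)).fun_pow 2).congr_deriv ?_
      have := h0 v hv
      norm_num
      field_simp) hwc
  have hder : ∫ v in s..1, 2 * C * (v ^ 2)⁻¹ = 2 * C * (s⁻¹ - 1) := by
    rw [intervalIntegral.integral_const_mul]
    congr 1
    have := intervalIntegral.integral_eq_sub_of_hasDerivAt (f := fun v : ℝ => -v⁻¹)
      (f' := fun v => (v ^ 2)⁻¹) (a := s) (b := 1)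
      (fun v hv => by
        rw [Set.uIcc_of_le hs1] at hv
        simpa using (hasDerivAt_inv (h0 v hv)).fun_neg)
      (ContinuousOn.intervalIntegrable (by
        rw [Set.uIcc_of_le hs1]
        exact ContinuousOn.inv₀ (by fun_prop) fun v hv => pow_ne_zero _ (h0 v hv)))
    rw [this]; simp; ring
  have hC0 : 0 ≤ C := by
    have := hC 1 one_pos; have := hF.eq_one 1 le_rfl; linarith
  have hmono : ∫ v in s..1, F v * (2 * (v ^ 3)⁻¹) ≤ ∫ v in s..1, 2 * C * (v ^ 2)⁻¹ := by
    refine intervalIntegral.integral_mono_on hs1 ?_ ?_ ?_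
    · exact (F.mono.intervalIntegrable).mul_continuousOn (by rwa [Set.uIcc_of_le hs1])
    · refine ContinuousOn.intervalIntegrable ?_
      rw [Set.uIcc_of_le hs1]
      exact continuousOn_const.mul
        (ContinuousOn.inv₀ (by fun_prop) fun v hv => pow_ne_zero _ (h0 v hv))
    · intro v hv
      have hv0 : 0 < v := hs.trans_le hv.1
      calc F v * (2 * (v ^ 3)⁻¹) ≤ (C * v) * (2 * (v ^ 3)⁻¹) := by
            gcongr; exact hC v hv0
        _ = 2 * C * (v ^ 2)⁻¹ := by field_simp
  rw [h]
  have : 1 ≤ s⁻¹ := (one_le_inv₀ hs).2 hs1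
  simp only [inv_one, one_pow]
  nlinarith

end IsUnitDistribution

/-! ### The Engel scheme as a Markov chain. -/

/-- The transition kernel of the Engel scheme: the law of `⌊h / U⌋`, with `U ∼ F`. -/
noncomputable def engelKernel (F : StieltjesFunction ℝ) : Kernel ℕ ℕ :=
  Kernel.ofFunOfCountable fun h => F.measure.map fun u => ⌊(h : ℝ) / u⌋₊

theorem measurable_floor_div (h : ℕ) : Measurable fun u : ℝ => ⌊(h : ℝ) / u⌋₊ :=
  Nat.measurable_floor.comp (measurable_const.div measurable_id)

theorem engelKernel_apply (F : StieltjesFunction ℝ) (h : ℕ) :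
    engelKernel F h = F.measure.map fun u => ⌊(h : ℝ) / u⌋₊ := rfl

theorem isMarkovKernel_engelKernel {F : StieltjesFunction ℝ} (hF : IsUnitDistribution F) :
    IsMarkovKernel (engelKernel F) := by
  have := hF.isProbabilityMeasure
  refine ⟨fun h => ?_⟩
  rw [engelKernel_apply]
  exact Measure.isProbabilityMeasure_map (measurable_floor_div h).aemeasurable

theorem floor_div_ge {u : ℝ} (hu : 0 < u ∧ u ≤ 1) (h : ℕ) : h ≤ ⌊(h : ℝ) / u⌋₊ :=
  Nat.le_floor (le_div_self h.cast_nonneg hu.1 hu.2)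

/-- For u > 0, ⌊h / u⌋ = k means h / (k + 1) < u ≤ h / k, a half-open interval of exactly the kind a
Stieltjes measure evaluates. For u ≤ 0 the floor is 0, whence `1 ≤ k`. -/
theorem engelKernel_singleton {F : StieltjesFunction ℝ} {h k : ℕ} (hk : 1 ≤ k) :
    engelKernel F h {k} = ENNReal.ofReal (F (h / k) - F (h / (k + 1))) := by
  rw [engelKernel_apply, Measure.map_apply (measurable_floor_div h) (measurableSet_singleton k),
    ← F.measure_Ioc]
  congr 1
  ext u
  have hk0 : (0 : ℝ) < k := by exact_mod_cast hk
  simp only [Set.mem_preimage, Set.mem_singleton_iff, Set.mem_Ioc]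
  rcases le_or_gt u 0 with hu | hu
  · have h1 : ⌊(h : ℝ) / u⌋₊ = 0 :=
      Nat.floor_of_nonpos (div_nonpos_of_nonneg_of_nonpos h.cast_nonneg hu)
    have h2 : (0 : ℝ) ≤ h / (k + 1) := by positivity
    constructor
    · intro h3; omega
    · rintro ⟨h3, -⟩; linarith
  · rw [Nat.floor_eq_iff (by positivity), le_div_iff₀ hu, div_lt_iff₀ hu, div_lt_iff₀ (by positivity),
      le_div_iff₀ hk0, and_comm, mul_comm u, mul_comm u]

theorem ae_engelKernel_ge {F : StieltjesFunction ℝ} (hF : IsUnitDistribution F) (h : ℕ) :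
    ∀ᵐ k ∂engelKernel F h, h ≤ k := by
  rw [engelKernel_apply]
  refine (ae_map_iff (measurable_floor_div h).aemeasurable (Set.to_countable _).measurableSet).2 ?_
  exact hF.ae_mem.mono fun u hu => floor_div_ge hu h

/-- The vector `(Θ₁, …, Θₙ₊₁)`. -/
def digitHistory {Ω : Type*} (Θ : ℕ → Ω → ℕ) (n : ℕ) (ω : Ω) : Fin (n + 1) → ℕ :=
  fun i => Θ (i + 1) ω

namespace IsOppenheimSequence

theorem measurable_digitHistory {Ω : Type*} [MeasurableSpace Ω] {P : Measure Ω}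
    {F : ℕ → StieltjesFunction ℝ} {Θ : ℕ → Ω → ℕ} {φ : ℕ → ℕ → ℝ} {q : (n : ℕ) → (Fin n → ℕ) → ℝ}
    (h : IsOppenheimSequence P F φ q Θ) (n : ℕ) : Measurable (digitHistory Θ n) :=
  measurable_pi_lambda _ fun i => h.measurable _ (by omega)

variable {Ω : Type*} [MeasurableSpace Ω] {P : Measure Ω} [IsProbabilityMeasure P]
  {F : ℕ → StieltjesFunction ℝ} {Θ : ℕ → Ω → ℕ}

/-- The conditional law is prescribed only along nondecreasing histories, so almost sure
monotonicity up to the present is assumed here and removed by `ae_monotone`. All spaces are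
countable, so the two measures need only agree on singletons. -/
theorem map_digitHistory_of_monotone
    (h : IsOppenheimSequence P F (fun _ h => (h : ℝ)) (fun _ _ => 0) Θ)
    (hF : ∀ n, 1 ≤ n → IsUnitDistribution (F n)) (n : ℕ)
    (hmono : ∀ᵐ ω ∂P, ∀ j, 2 ≤ j → j ≤ n + 1 → Θ (j - 1) ω ≤ Θ j ω) :
    P.map (fun ω => (digitHistory Θ n ω, Θ (n + 2) ω)) =
      (P.map (digitHistory Θ n)) ⊗ₘ
        (engelKernel (F (n + 1))).comap (fun x => x (Fin.last n)) (measurable_pi_apply _) := by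
  have hFn := hF (n + 1) (by omega)
  have := isMarkovKernel_engelKernel hFn
  have hH := h.measurable_digitHistory n
  have hΘ := h.measurable (n + 2) (by omega)
  have := Measure.isProbabilityMeasure_map (μ := P) hH.aemeasurable
  refine Measure.ext_of_singleton fun p => ?_
  obtain ⟨x, y⟩ := p
  rw [Measure.map_apply (hH.prodMk hΘ) (measurableSet_singleton _), ← Set.singleton_prod_singleton,
    Measure.compProd_apply_prod (measurableSet_singleton _) (measurableSet_singleton _),
    lintegral_singleton, Measure.map_apply hH (measurableSet_singleton _), Set.mk_preimage_prod,
    Kernel.comap_apply]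
  by_cases hC : P (digitHistory Θ n ⁻¹' {x}) = 0
  · rw [hC, mul_zero]
    exact measure_mono_null Set.inter_subset_left hC
  have hpos : ∀ᵐ ω ∂P, ∀ j, 1 ≤ j → 1 ≤ Θ j ω := by
    rw [ae_all_iff]; intro j
    by_cases hj : 1 ≤ j
    · exact (h.pos j hj).mono fun ω hω _ => hω
    · exact Eventually.of_forall fun ω h' => absurd h' hj
  -- A cylinder of positive measure contains a point outside the null set, so the history `x` is
  -- itself admissible.
  obtain ⟨ω₀, hω₀, hx⟩ : ∃ ω₀, (∀ j, 2 ≤ j → j ≤ n + 1 → Θ (j - 1) ω₀ ≤ Θ j ω₀) ∧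
      digitHistory Θ n ω₀ = x ∧ ∀ j, 1 ≤ j → 1 ≤ Θ j ω₀ := by
    by_contra hne
    push Not at hne
    refine hC (measure_mono_null ?_ (hmono.and hpos))
    intro ω hω h'
    obtain ⟨j, hj, hj'⟩ := hne ω h'.1 hω
    exact absurd (h'.2 j hj) (by omega)
  obtain ⟨rfl, hx1⟩ := hx
  rcases Nat.eq_zero_or_pos y with rfl | hy
  · have h1 : P (Θ (n + 2) ⁻¹' {0}) = 0 := by
      refine measure_mono_null ?_ (ae_iff.1 (h.pos (n + 2) (by omega)))
      intro ω hω
      have : Θ (n + 2) ω = 0 := hω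
      simp [this]
    have h2 : engelKernel (F (n + 1)) (digitHistory Θ n ω₀ (Fin.last n)) {0} = 0 := by
      refine measure_mono_null ?_ (ae_iff.1 (ae_engelKernel_ge hFn _))
      intro k hk
      have hk : k = 0 := hk
      have : 1 ≤ digitHistory Θ n ω₀ (Fin.last n) := hx1 (n + 1) (by omega)
      simp only [Set.mem_ofPred_eq, not_le]
      omega
    rw [h2, zero_mul]
    exact measure_mono_null Set.inter_subset_right h1
  -- The infinite sequence fed to `cond_law` is the history of ω₀ continued by the constant `y`.
  · have hset : {ω | ∀ j, 1 ≤ j → j ≤ n + 1 → Θ j ω = if j ≤ n + 1 then Θ j ω₀ else y} =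
        digitHistory Θ n ⁻¹' {digitHistory Θ n ω₀} := by
      ext ω
      simp only [Set.mem_ofPred_eq, Set.mem_preimage, Set.mem_singleton_iff, funext_iff,
        digitHistory]
      constructor
      · intro h' i
        have := h' (i + 1) (by omega) (by omega)
        rwa [if_pos (by omega)] at this
      · intro h' j hj hj'
        rw [if_pos hj']
        have := h' ⟨j - 1, by omega⟩
        simpa [Nat.sub_add_cancel hj] using this
    have hlaw := h.cond_law (n + 1) (by omega) (fun j => if j ≤ n + 1 then Θ j ω₀ else y)
      (by simpa using hx1 1 le_rfl) (by simpa [Nat.one_le_iff_ne_zero, Nat.pos_iff_ne_zero] using hy)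
      (fun j hj hj' => by
        have : j - 1 ≤ n + 1 := by omega
        simpa [hj', this] using hω₀ j hj hj')
      (by rw [hset]; exact hC)
    rw [hset, cond_apply (hH (measurableSet_singleton _))] at hlaw
    rw [engelKernel_singleton hy]
    have hset2 : {ω | Θ (n + 1 + 1) ω = if n + 1 + 1 ≤ n + 1 then Θ (n + 1 + 1) ω₀ else y} =
        Θ (n + 2) ⁻¹' {y} := by
      ext ω; simp
    rw [hset2] at hlaw
    have hval : digitHistory Θ n ω₀ (Fin.last n) = Θ (n + 1) ω₀ := rfl
    simp only [oppenheimDelta, mul_zero, add_zero, mul_one, le_refl, if_true,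
      if_neg (show ¬ (n + 1 + 1 ≤ n + 1) by omega), Nat.cast_add, Nat.cast_one] at hlaw
    rw [hval, ← hlaw, mul_comm, ← mul_assoc, ENNReal.mul_inv_cancel hC (measure_ne_top _ _), one_mul]

/-- Bootstrap: monotonicity up to time n + 1 identifies the next transition with the kernel, and the
kernel started at h only charges integers ≥ h. -/
theorem ae_monotone (h : IsOppenheimSequence P F (fun _ h => (h : ℝ)) (fun _ _ => 0) Θ)
    (hF : ∀ n, 1 ≤ n → IsUnitDistribution (F n)) (n : ℕ) :
    ∀ᵐ ω ∂P, ∀ j, 2 ≤ j → j ≤ n + 1 → Θ (j - 1) ω ≤ Θ j ω := by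
  induction n with
  | zero => exact Eventually.of_forall fun ω j h1 h2 => by omega
  | succ n ih =>
    have hFn := hF (n + 1) (by omega)
    have := isMarkovKernel_engelKernel hFn
    have hH := h.measurable_digitHistory n
    have hΘ := h.measurable (n + 2) (by omega)
    have := Measure.isProbabilityMeasure_map (μ := P) hH.aemeasurable
    have hmap := h.map_digitHistory_of_monotone hF n ih
    have hae : ∀ᵐ p ∂P.map (fun ω => (digitHistory Θ n ω, Θ (n + 2) ω)),
        p.1 (Fin.last n) ≤ p.2 := by
      rw [hmap, Measure.ae_compProd_iff (Set.to_countable _).measurableSet]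
      exact Eventually.of_forall fun x => by
        rw [Kernel.comap_apply]; exact ae_engelKernel_ge hFn _
    have hae := ae_of_ae_map (hH.prodMk hΘ).aemeasurable hae
    filter_upwards [ih, hae] with ω h1 h2 j hj hj'
    rcases Nat.lt_or_ge (n + 1) j with hlt | hge
    · obtain rfl : j = n + 2 := by omega
      exact h2
    · exact h1 j hj hge

/-- Conditionally on the past, `Θₙ₊₂` is distributed as `⌊Θₙ₊₁ / U⌋` with `U ∼ Fₙ₊₁`. -/
theorem integral_digitHistory
    (h : IsOppenheimSequence P F (fun _ h => (h : ℝ)) (fun _ _ => 0) Θ)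
    (hF : ∀ n, 1 ≤ n → IsUnitDistribution (F n)) (n : ℕ) (f : (Fin (n + 1) → ℕ) → ℕ → ℝ)
    {C : ℝ} (hC : ∀ x y, |f x y| ≤ C) :
    ∫ ω, f (digitHistory Θ n ω) (Θ (n + 2) ω) ∂P =
      ∫ ω, ∫ u, f (digitHistory Θ n ω) ⌊(Θ (n + 1) ω : ℝ) / u⌋₊ ∂(F (n + 1)).measure ∂P := by
  have hFn := hF (n + 1) (by omega)
  have := isMarkovKernel_engelKernel hFn
  have hH := h.measurable_digitHistory n
  have hΘ := h.measurable (n + 2) (by omega)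
  have := Measure.isProbabilityMeasure_map (μ := P) hH.aemeasurable
  have hmap := h.map_digitHistory_of_monotone hF n (h.ae_monotone hF n)
  have hf : Measurable fun p : (Fin (n + 1) → ℕ) × ℕ => f p.1 p.2 := measurable_of_countable _
  have h1 := integral_map (μ := P) (hH.prodMk hΘ).aemeasurable
    (f := fun p => f p.1 p.2) hf.aestronglyMeasurable
  rw [← h1, hmap, Measure.integral_compProd, integral_map hH.aemeasurable]
  · refine integral_congr_ae (Eventually.of_forall fun ω => ?_)
    simp only [Kernel.comap_apply, engelKernel_apply]
    rw [integral_map (measurable_floor_div _).aemeasurable]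
    · rfl
    · exact (measurable_of_countable _).aestronglyMeasurable
  · exact (measurable_of_countable _).aestronglyMeasurable
  · exact Integrable.of_bound hf.aestronglyMeasurable C (Eventually.of_forall fun p => hC p.1 p.2)

end IsOppenheimSequence

/-! ### Martingale second moments and growth of the digits. -/

theorem integrable_comp_floor_div {F : StieltjesFunction ℝ} (hF : IsUnitDistribution F)
    (h : ℕ) (f : ℕ → ℝ) {B : ℝ} (hB : ∀ y, |f y| ≤ B) :
    Integrable (fun u => f ⌊(h : ℝ) / u⌋₊) F.measure := by
  have := hF.isProbabilityMeasure
  exact Integrable.of_bound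
    ((measurable_of_countable f).comp (measurable_floor_div h)).aestronglyMeasurable B
    (Eventually.of_forall fun u => hB _)

/-- Centring kills the cross term, and the variance is at most the second moment. -/
theorem integral_add_sub_integral_sq_le {Ω : Type*} [MeasurableSpace Ω] {μ : Measure Ω}
    [IsProbabilityMeasure μ] {X : Ω → ℝ} (hX : Integrable X μ)
    (hX2 : Integrable (fun ω => X ω ^ 2) μ) (s : ℝ) :
    ∫ ω, (s + (X ω - ∫ ω', X ω' ∂μ)) ^ 2 ∂μ ≤ s ^ 2 + ∫ ω, X ω ^ 2 ∂μ := by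
  set e := ∫ ω', X ω' ∂μ with he
  have h1 : (fun ω => (s + (X ω - e)) ^ 2) =
      fun ω => X ω ^ 2 + (2 * (s - e) * X ω + (s - e) ^ 2) := by ext ω; ring
  have h2 : Integrable (fun ω => 2 * (s - e) * X ω + (s - e) ^ 2) μ :=
    (hX.const_mul _).add (integrable_const _)
  rw [h1, integral_add hX2 h2,
    integral_add (hX.const_mul _) (integrable_const _), integral_const_mul, ← he, integral_const,
    probReal_univ, one_smul]
  nlinarith [sq_nonneg e]

namespace IsOppenheimSequence

variable {Ω : Type*} [MeasurableSpace Ω] {P : Measure Ω} [IsProbabilityMeasure P]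
  {F : ℕ → StieltjesFunction ℝ} {Θ : ℕ → Ω → ℕ}

theorem integrable_of_bounded
    (h : IsOppenheimSequence P F (fun _ h => (h : ℝ)) (fun _ _ => 0) Θ) (n : ℕ)
    (f : (Fin (n + 1) → ℕ) → ℝ) {C : ℝ} (hC : ∀ x, |f x| ≤ C) :
    Integrable (fun ω => f (digitHistory Θ n ω)) P :=
  Integrable.of_bound ((measurable_of_countable f).comp
    (h.measurable_digitHistory n)).aestronglyMeasurable C (Eventually.of_forall fun _ => hC _)

/-- Second-moment bound for the sum of the centred increments `gₘ(Θₘ₊₁, Θₘ₊₂)`. -/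
theorem exists_sum_centred_sq_le
    (h : IsOppenheimSequence P F (fun _ h => (h : ℝ)) (fun _ _ => 0) Θ)
    (hF : ∀ n, 1 ≤ n → IsUnitDistribution (F n)) (g : ℕ → ℕ → ℕ → ℝ) {B : ℝ}
    (hB : ∀ m x y, |g m x y| ≤ B) {v : ℕ → ℝ} (n : ℕ)
    (hv : ∀ m < n, ∀ x : ℕ, ∫ u, g m x ⌊(x : ℝ) / u⌋₊ ^ 2 ∂(F (m + 1)).measure ≤ v m) :
    ∃ (f : (Fin (n + 1) → ℕ) → ℝ) (C : ℝ), (∀ x, |f x| ≤ C) ∧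
      (∀ ω, ∑ m ∈ Finset.range n, (g m (Θ (m + 1) ω) (Θ (m + 2) ω) -
        ∫ u, g m (Θ (m + 1) ω) ⌊(Θ (m + 1) ω : ℝ) / u⌋₊ ∂(F (m + 1)).measure) =
          f (digitHistory Θ n ω)) ∧
      ∫ ω, f (digitHistory Θ n ω) ^ 2 ∂P ≤ ∑ m ∈ Finset.range n, v m := by
  induction n with
  | zero => exact ⟨fun _ => 0, 0, by simp, by simp, by simp⟩
  | succ n ih =>
    obtain ⟨f, C, hfC, hf, hf2⟩ := ih fun m hm => hv m (by omega)
    have hFn := hF (n + 1) (by omega)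
    have := hFn.isProbabilityMeasure
    set G : ℕ → ℝ := fun x => ∫ u, g n x ⌊(x : ℝ) / u⌋₊ ∂(F (n + 1)).measure with hG
    have hGB : ∀ x, |G x| ≤ B := fun x => by
      have := norm_integral_le_of_norm_le_const (μ := (F (n + 1)).measure)
        (f := fun u => g n x ⌊(x : ℝ) / u⌋₊) (Eventually.of_forall fun u => hB n x _)
      simpa using this
    have hbd : ∀ (x : Fin (n + 1) → ℕ) (y k : ℕ), |f x + (g n k y - G k)| ≤ C + (B + B) :=
      fun x y k => (abs_add_le _ _).trans
        (add_le_add (hfC x) ((abs_sub _ _).trans (add_le_add (hB _ _ _) (hGB _))))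
    have hbd2 : ∀ (x : Fin (n + 1) → ℕ) (y k : ℕ),
        |(f x + (g n k y - G k)) ^ 2| ≤ (C + (B + B)) ^ 2 := fun x y k => by
      rw [abs_pow]; exact pow_le_pow_left₀ (abs_nonneg _) (hbd x y k) 2
    refine ⟨fun x => f (Fin.init x) +
      (g n (x (Fin.last n).castSucc) (x (Fin.last (n + 1))) - G (x (Fin.last n).castSucc)),
      C + (B + B), fun x => hbd _ _ _, fun ω => ?_, ?_⟩
    · rw [Finset.sum_range_succ, hf]; rfl
    · have h1 := h.integral_digitHistory hF n
        (fun x y => (f x + (g n (x (Fin.last n)) y - G (x (Fin.last n)))) ^ 2)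
        (fun x y => hbd2 x y _)
      have hfi : Integrable (fun ω => f (digitHistory Θ n ω) ^ 2) P :=
        h.integrable_of_bounded n (fun x => f x ^ 2) (C := C ^ 2) fun x => by
          rw [abs_pow]; exact pow_le_pow_left₀ (abs_nonneg _) (hfC x) 2
      calc _ = _ := h1
        -- With the history frozen, the new increment has mean zero under U; this is orthogonality
        -- of martingale differences.
        _ ≤ ∫ ω, (f (digitHistory Θ n ω) ^ 2 + v n) ∂P := by
          refine integral_mono_of_nonneg
            (Eventually.of_forall fun ω => integral_nonneg fun u => sq_nonneg _)
            (hfi.add (integrable_const _)) (Eventually.of_forall fun ω => ?_)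
          refine (integral_add_sub_integral_sq_le
            (integrable_comp_floor_div hFn (Θ (n + 1) ω) (g n (Θ (n + 1) ω)) (hB n _))
            (integrable_comp_floor_div hFn (Θ (n + 1) ω) (fun y => g n (Θ (n + 1) ω) y ^ 2)
              (B := B ^ 2) fun y => by
                rw [abs_pow]; exact pow_le_pow_left₀ (abs_nonneg _) (hB _ _ _) 2) _).trans ?_
          exact add_le_add_right (hv n (by omega) _) _
        _ ≤ _ := by
          rw [integral_add hfi (integrable_const _), integral_const, probReal_univ, one_smul,
            Finset.sum_range_succ]
          exact add_le_add_left hf2 _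

/-- With probability at least p one has U ≤ 1/2. Then Θ at least doubles and, since x ≥ 1, (x + 1) /
(2x + 1) ≤ 2/3; otherwise 1 / (Θ + 1) does not increase. Each step thus contracts the expectation by
1 - p / 3. -/
theorem integral_inv_succ_le
    (h : IsOppenheimSequence P F (fun _ h => (h : ℝ)) (fun _ _ => 0) Θ)
    (hF : ∀ n, 1 ≤ n → IsUnitDistribution (F n)) {p : ℝ} (hp : ∀ n, 1 ≤ n → p ≤ F n (1 / 2))
    (n : ℕ) : ∫ ω, ((Θ (n + 1) ω : ℝ) + 1)⁻¹ ∂P ≤ (1 - p / 3) ^ n := by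
  have hb : ∀ y : ℕ, |((y : ℝ) + 1)⁻¹| ≤ 1 := fun y => by
    rw [abs_of_nonneg (by positivity)]
    exact inv_le_one_of_one_le₀ (by linarith [(Nat.cast_nonneg y : (0 : ℝ) ≤ y)])
  have hint : ∀ n, Integrable (fun ω => ((Θ (n + 1) ω : ℝ) + 1)⁻¹) P := fun n =>
    h.integrable_of_bounded n (fun x => ((x (Fin.last n) : ℝ) + 1)⁻¹) fun x => hb _
  induction n with
  | zero =>
    calc _ ≤ ∫ ω, (1 : ℝ) ∂P :=
          integral_mono (hint 0) (integrable_const _) fun ω => (le_abs_self _).trans (hb _)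
      _ ≤ _ := by simp
  | succ n ih =>
    have hFn := hF (n + 1) (by omega)
    have := hFn.isProbabilityMeasure
    have hp1 : 0 ≤ 1 - p / 3 := by
      have := hp 1 le_rfl; have := (hF 1 le_rfl).le_one (1 / 2); linarith
    have h1 := h.integral_digitHistory hF n (fun _ y => ((y : ℝ) + 1)⁻¹) (fun _ y => hb y)
    calc ∫ ω, ((Θ (n + 1 + 1) ω : ℝ) + 1)⁻¹ ∂P = _ := h1
      _ ≤ ∫ ω, (1 - p / 3) * ((Θ (n + 1) ω : ℝ) + 1)⁻¹ ∂P := by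
        refine integral_mono_of_nonneg
          (Eventually.of_forall fun ω => integral_nonneg fun u => by positivity)
          ((hint n).const_mul _) ?_
        filter_upwards [h.pos (n + 1) (by omega)] with ω hω
        set x : ℕ := Θ (n + 1) ω
        have hx : (1 : ℝ) ≤ x := by exact_mod_cast hω
        have hint2 : Integrable ((Set.Iic (1 / 2 : ℝ)).indicator fun _ => (1 / 3 : ℝ))
            (F (n + 1)).measure := (integrable_const _).indicator measurableSet_Iic
        calc ∫ u, ((⌊(x : ℝ) / u⌋₊ : ℝ) + 1)⁻¹ ∂(F (n + 1)).measure
            ≤ ∫ u, (1 - (Set.Iic (1 / 2 : ℝ)).indicator (fun _ => (1 / 3 : ℝ)) u) *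
                ((x : ℝ) + 1)⁻¹ ∂(F (n + 1)).measure := by
              refine integral_mono_ae
                (integrable_comp_floor_div hFn x (fun y => ((y : ℝ) + 1)⁻¹) hb)
                (((integrable_const _).sub hint2).mul_const _) ?_
              filter_upwards [hFn.ae_mem] with u hu
              have hge : (x : ℝ) ≤ (⌊(x : ℝ) / u⌋₊ : ℝ) := by exact_mod_cast floor_div_ge hu x
              by_cases hu2 : u ≤ 1 / 2
              · rw [Set.indicator_of_mem (Set.mem_Iic.2 hu2)]
                have hge2 : ((2 * x : ℕ) : ℝ) ≤ (⌊(x : ℝ) / u⌋₊ : ℝ) := by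
                  refine Nat.cast_le.2 (Nat.le_floor ?_)
                  rw [le_div_iff₀ hu.1]; push_cast; nlinarith
                push_cast at hge2
                rw [← div_eq_mul_inv, inv_eq_one_div, div_le_div_iff₀ (by positivity) (by positivity)]
                nlinarith
              · rw [Set.indicator_of_notMem (by simpa using hu2), sub_zero, one_mul]
                exact inv_anti₀ (by positivity) (by linarith)
          _ = (1 - F (n + 1) (1 / 2) / 3) * ((x : ℝ) + 1)⁻¹ := by
              rw [integral_mul_const, integral_sub (integrable_const _) hint2,
                integral_indicator_const _ measurableSet_Iic, hFn.measureReal_Iic, integral_const,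
                probReal_univ, one_smul, smul_eq_mul]
              ring
          _ ≤ (1 - p / 3) * ((x : ℝ) + 1)⁻¹ := by
              have := hp (n + 1) (by omega)
              gcongr
      _ ≤ (1 - p / 3) ^ (n + 1) := by
        rw [integral_const_mul, pow_succ, mul_comm]
        exact mul_le_mul_of_nonneg_right ih hp1

end IsOppenheimSequence

/-! ### Truncated ratios compared with `w / max U w`. -/

/-- The weighted ratio `w (y + 1) / (x + 1)` of consecutive digits, truncated at `1`. -/
noncomputable def truncatedRatio (w : ℝ) (x y : ℕ) : ℝ := min (w * (((y : ℝ) + 1) / (x + 1))) 1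

theorem truncatedRatio_nonneg {w : ℝ} (hw : 0 ≤ w) (x y : ℕ) : 0 ≤ truncatedRatio w x y :=
  le_min (by positivity) zero_le_one

theorem abs_truncatedRatio_le {w : ℝ} (hw : 0 ≤ w) (x y : ℕ) : |truncatedRatio w x y| ≤ 1 := by
  rw [abs_of_nonneg (truncatedRatio_nonneg hw x y)]
  exact min_le_right _ _

theorem mul_inv_max {w u : ℝ} (hw : 0 < w) (hu : 0 < u) : w * (max u w)⁻¹ = min (w / u) 1 := by
  rcases le_total u w with h | h
  · rw [max_eq_right h, min_eq_right ((one_le_div₀ hu).2 h), mul_inv_cancel₀ hw.ne']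
  · rw [max_eq_left h, min_eq_left ((div_le_one₀ hu).2 h), div_eq_mul_inv]

/-- As 1 ≤ 1 / u, ⌊x / u⌋ + 1 ≤ (x + 1) / u: the shift from Θ to D can only lower the ratio below 1
/ u. -/
theorem truncatedRatio_floor_le {w u : ℝ} (hw : 0 < w) (hu : 0 < u ∧ u ≤ 1) (x : ℕ) :
    truncatedRatio w x ⌊(x : ℝ) / u⌋₊ ≤ w * (max u w)⁻¹ := by
  have hu0 := hu.1
  rw [mul_inv_max hw hu0, div_eq_mul_inv w u]
  refine min_le_min_right _ (mul_le_mul_of_nonneg_left ?_ hw.le)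
  rw [div_le_iff₀ (by positivity)]
  have h1 : (⌊(x : ℝ) / u⌋₊ : ℝ) ≤ x * u⁻¹ := by
    rw [← div_eq_mul_inv]
    exact Nat.floor_le (by positivity)
  have h2 : 1 ≤ u⁻¹ := (one_le_inv₀ hu0).2 hu.2
  linarith

/-- Here ⌊x / u⌋ + 1 > x / u, so the ratio loses at most the factor x / (x + 1). -/
theorem le_truncatedRatio_floor {w u : ℝ} (hw : 0 < w) (hu : 0 < u ∧ u ≤ 1) (x : ℕ) :
    (1 - ((x : ℝ) + 1)⁻¹) * (w * (max u w)⁻¹) ≤ truncatedRatio w x ⌊(x : ℝ) / u⌋₊ := by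
  have hu0 := hu.1
  have hx : 1 - ((x : ℝ) + 1)⁻¹ = x / (x + 1) := by field_simp; ring
  have hx1 : (x : ℝ) / (x + 1) ≤ 1 := (div_le_one₀ (by positivity)).2 (by linarith)
  have h0 : (0 : ℝ) ≤ x / (x + 1) := by positivity
  rw [mul_inv_max hw hu0, hx]
  refine le_min ?_ ?_
  · calc (x : ℝ) / (x + 1) * min (w / u) 1 ≤ x / (x + 1) * (w / u) := by
          gcongr; exact min_le_left _ _
      _ = w * ((x / u) / (x + 1)) := by ring
      _ ≤ w * ((⌊(x : ℝ) / u⌋₊ + 1) / (x + 1)) := by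
          gcongr; exact (Nat.lt_floor_add_one _).le
  · exact mul_le_one₀ hx1 (by positivity) (min_le_right _ _)

namespace IsUnitDistribution

variable {F : StieltjesFunction ℝ}

theorem integrable_comp_inv_max (hF : IsUnitDistribution F) {w : ℝ} (hw : 0 < w) (k : ℕ) :
    Integrable (fun u => ((max u w)⁻¹) ^ k) F.measure := by
  have := hF.isProbabilityMeasure
  refine Integrable.of_bound (by fun_prop) ((w⁻¹) ^ k) (Eventually.of_forall fun u => ?_)
  have : 0 < max u w := hw.trans_le (le_max_right _ _)
  rw [Real.norm_of_nonneg (by positivity)]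
  gcongr
  exact le_max_right _ _

theorem integral_truncatedRatio_sq_le (hF : IsUnitDistribution F) {w C : ℝ} (hw : 0 < w)
    (hw1 : w ≤ 1) (hC : ∀ t, 0 < t → F t ≤ C * t) (x : ℕ) :
    ∫ u, truncatedRatio w x ⌊(x : ℝ) / u⌋₊ ^ 2 ∂F.measure ≤ (1 + 2 * C) * w := by
  calc ∫ u, truncatedRatio w x ⌊(x : ℝ) / u⌋₊ ^ 2 ∂F.measure
      ≤ ∫ u, w ^ 2 * ((max u w)⁻¹) ^ 2 ∂F.measure := by
        refine integral_mono_of_nonneg (Eventually.of_forall fun u => sq_nonneg _)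
          ((hF.integrable_comp_inv_max hw 2).const_mul _) ?_
        filter_upwards [hF.ae_mem] with u hu
        rw [← mul_pow]
        exact pow_le_pow_left₀ (truncatedRatio_nonneg hw.le _ _) (truncatedRatio_floor_le hw hu x) 2
    _ ≤ w ^ 2 * ((1 + 2 * C) * w⁻¹) := by
        rw [integral_const_mul]
        exact mul_le_mul_of_nonneg_left (hF.integral_inv_max_sq_le hw hw1 hC) (sq_nonneg _)
    _ = (1 + 2 * C) * w := by field_simp

theorem abs_integral_truncatedRatio_sub_le (hF : IsUnitDistribution F) {w : ℝ} (hw : 0 < w)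
    (x : ℕ) :
    |∫ u, truncatedRatio w x ⌊(x : ℝ) / u⌋₊ ∂F.measure - w * ∫ u, (max u w)⁻¹ ∂F.measure| ≤
      w * (∫ u, (max u w)⁻¹ ∂F.measure) * ((x : ℝ) + 1)⁻¹ := by
  have hi : Integrable (fun u => (max u w)⁻¹) F.measure := by
    simpa using hF.integrable_comp_inv_max hw 1
  have hg := integrable_comp_floor_div hF x (truncatedRatio w x) (abs_truncatedRatio_le hw.le x)
  have h1 : ∫ u, truncatedRatio w x ⌊(x : ℝ) / u⌋₊ ∂F.measure ≤
      ∫ u, w * (max u w)⁻¹ ∂F.measure :=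
    integral_mono_ae hg (hi.const_mul _) (hF.ae_mem.mono fun u hu => truncatedRatio_floor_le hw hu x)
  have h2 : ∫ u, (1 - ((x : ℝ) + 1)⁻¹) * (w * (max u w)⁻¹) ∂F.measure ≤
      ∫ u, truncatedRatio w x ⌊(x : ℝ) / u⌋₊ ∂F.measure :=
    integral_mono_ae ((hi.const_mul _).const_mul _) hg
      (hF.ae_mem.mono fun u hu => le_truncatedRatio_floor hw hu x)
  rw [integral_const_mul] at h1 h2
  rw [integral_const_mul] at h2
  rw [abs_sub_le_iff]
  have h3 : 0 ≤ ∫ u, (max u w)⁻¹ ∂F.measure := integral_nonneg fun u => by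
    have : 0 < max u w := hw.trans_le (le_max_right _ _)
    positivity
  have : 0 ≤ w * (∫ u, (max u w)⁻¹ ∂F.measure) * ((x : ℝ) + 1)⁻¹ := by positivity
  constructor <;> linarith

end IsUnitDistribution

/-! ### Deviation bound. -/

/-- Non-asymptotic deviation bound for weighted sums of ratios of consecutive digits. -/
theorem IsOppenheimSequence.measureReal_sum_ratio_sub_ge_le
    {Ω : Type*} [MeasurableSpace Ω] {P : Measure Ω} [IsProbabilityMeasure P]
    {F : ℕ → StieltjesFunction ℝ} {Θ : ℕ → Ω → ℕ}
    (h : IsOppenheimSequence P F (fun _ h => (h : ℝ)) (fun _ _ => 0) Θ)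
    (hF : ∀ n, 1 ≤ n → IsUnitDistribution (F n)) {p C : ℝ}
    (hp : ∀ n, 1 ≤ n → p ≤ F n (1 / 2)) (hC : ∀ n, 1 ≤ n → ∀ t, 0 < t → F n t ≤ C * t)
    {w : ℕ → ℝ} {n : ℕ} (hw : ∀ m < n, 0 < w m) (hw1 : ∀ m < n, w m ≤ 1) {ε : ℝ} (hε : 0 < ε) :
    P.real {ω | 2 * ε ≤ |∑ m ∈ Finset.range n,
        w m * (((Θ (m + 2) ω : ℝ) + 1) / (Θ (m + 1) ω + 1)) -
      ∑ m ∈ Finset.range n, w m * ∫ u, (max u (w m))⁻¹ ∂(F (m + 1)).measure|} ≤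
    (1 + 2 * C) * (1 + 1 / ε ^ 2) * ∑ m ∈ Finset.range n, w m +
      1 / ε * ∑ m ∈ Finset.range n,
        w m * (∫ u, (max u (w m))⁻¹ ∂(F (m + 1)).measure) * (1 - p / 3) ^ m := by
  set M : ℕ → ℝ := fun m => ∫ u, (max u (w m))⁻¹ ∂(F (m + 1)).measure with hM
  -- Extension by 0 beyond n, because the second-moment lemma asks for a bound at every index while
  -- `w` is controlled only for `m < n`.
  set g : ℕ → ℕ → ℕ → ℝ := fun m x y => if m < n then truncatedRatio (w m) x y else 0 with hg
  set G : ℕ → ℕ → ℝ := fun m x => ∫ u, g m x ⌊(x : ℝ) / u⌋₊ ∂(F (m + 1)).measure with hG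
  have hgB : ∀ m x y, |g m x y| ≤ 1 := fun m x y => by
    by_cases hm : m < n
    · simpa [hg, hm] using abs_truncatedRatio_le (hw m hm).le x y
    · simp [hg, hm]
  have hgv : ∀ m < n, ∀ x : ℕ,
      ∫ u, g m x ⌊(x : ℝ) / u⌋₊ ^ 2 ∂(F (m + 1)).measure ≤ (1 + 2 * C) * w m := fun m hm x => by
    simp only [hg, hm, if_true]
    exact (hF (m + 1) (by omega)).integral_truncatedRatio_sq_le (hw m hm) (hw1 m hm)
      (hC _ (by omega)) x
  have hMnn : ∀ m < n, 0 ≤ w m * M m := fun m hm => by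
    refine mul_nonneg (hw m hm).le (integral_nonneg fun u => ?_)
    have : 0 < max u (w m) := (hw m hm).trans_le (le_max_right _ _)
    positivity
  obtain ⟨f, B, hfB, hf, hf2⟩ := h.exists_sum_centred_sq_le hF g hgB n hgv
  -- Three bad events: a truncation is active (as 0 ≤ g ≤ 1, this reads g² ≥ 1), the martingale part
  -- is large, the bias of the conditional means is large. Markov's inequality handles each;
  -- squaring in `E1` gives a bound linear in w without a logarithm.
  set E1 : ℕ → Set Ω := fun m => {ω | 1 ≤ g m (Θ (m + 1) ω) (Θ (m + 2) ω) ^ 2}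
  set E2 : Set Ω := {ω | ε ^ 2 ≤ f (digitHistory Θ n ω) ^ 2}
  set E3 : Set Ω := {ω | ε ≤ ∑ m ∈ Finset.range n, w m * M m * ((Θ (m + 1) ω : ℝ) + 1)⁻¹}
  have hE1 : ∀ m < n, P.real (E1 m) ≤ (1 + 2 * C) * w m := fun m hm => by
    have hb : ∀ x y, |g m x y ^ 2| ≤ 1 := fun x y => by
      rw [abs_pow]; exact pow_le_one₀ (abs_nonneg _) (hgB m x y)
    have hint : Integrable (fun ω => g m (Θ (m + 1) ω) (Θ (m + 2) ω) ^ 2) P :=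
      h.integrable_of_bounded (m + 1)
        (fun x => g m (x (Fin.last m).castSucc) (x (Fin.last (m + 1))) ^ 2) fun x => hb _ _
    have h1 := mul_meas_ge_le_integral_of_nonneg
      (Eventually.of_forall fun ω => sq_nonneg _) hint 1
    rw [one_mul] at h1
    have hFm := (hF (m + 1) (by omega)).isProbabilityMeasure
    have h2 := h.integral_digitHistory hF m (fun x y => g m (x (Fin.last m)) y ^ 2)
      (fun x y => hb _ _)
    calc P.real (E1 m) ≤ _ := h1
      _ = _ := h2
      _ ≤ ∫ ω, (1 + 2 * C) * w m ∂P :=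
        integral_mono_of_nonneg (Eventually.of_forall fun ω => integral_nonneg fun u => sq_nonneg _)
          (integrable_const _) (Eventually.of_forall fun ω => hgv m hm _)
      _ = _ := by simp
  have hE2 : P.real E2 ≤ 1 / ε ^ 2 * ((1 + 2 * C) * ∑ m ∈ Finset.range n, w m) := by
    have hint : Integrable (fun ω => f (digitHistory Θ n ω) ^ 2) P :=
      h.integrable_of_bounded n (fun x => f x ^ 2) (C := B ^ 2) fun x => by
        rw [abs_pow]; exact pow_le_pow_left₀ (abs_nonneg _) (hfB x) 2
    have h1 := mul_meas_ge_le_integral_of_nonneg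
      (Eventually.of_forall fun ω => sq_nonneg _) hint (ε ^ 2)
    rw [← Finset.mul_sum] at hf2
    rw [one_div, ← div_eq_inv_mul, le_div_iff₀ (by positivity), mul_comm]
    exact h1.trans hf2
  have hE3 : P.real E3 ≤ 1 / ε * ∑ m ∈ Finset.range n, w m * M m * (1 - p / 3) ^ m := by
    have hint : ∀ m ∈ Finset.range n,
        Integrable (fun ω => w m * M m * ((Θ (m + 1) ω : ℝ) + 1)⁻¹) P := fun m _ =>
      (h.integrable_of_bounded m (fun x => ((x (Fin.last m) : ℝ) + 1)⁻¹) (C := 1) fun x => by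
        rw [abs_of_nonneg (by positivity)]
        exact inv_le_one_of_one_le₀
          (by linarith [(Nat.cast_nonneg (x (Fin.last m)) : (0 : ℝ) ≤ _)])).const_mul _
    have h1 := mul_meas_ge_le_integral_of_nonneg
      (Eventually.of_forall fun ω => Finset.sum_nonneg fun m hm =>
        mul_nonneg (hMnn m (Finset.mem_range.1 hm)) (by positivity))
      (integrable_finsetSum _ hint) ε
    rw [integral_finsetSum _ hint] at h1
    rw [one_div, ← div_eq_inv_mul, le_div_iff₀ hε, mul_comm]
    refine h1.trans (Finset.sum_le_sum fun m hm => ?_)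
    rw [integral_const_mul]
    exact mul_le_mul_of_nonneg_left (h.integral_inv_succ_le hF hp m)
      (hMnn m (Finset.mem_range.1 hm))
  have hsub : {ω | 2 * ε ≤ |∑ m ∈ Finset.range n,
        w m * (((Θ (m + 2) ω : ℝ) + 1) / (Θ (m + 1) ω + 1)) -
      ∑ m ∈ Finset.range n, w m * M m|} ⊆ (⋃ m ∈ Finset.range n, E1 m) ∪ (E2 ∪ E3) := by
    intro ω hω
    by_contra hne
    simp only [Set.mem_union, Set.mem_iUnion, not_or, not_exists, Finset.mem_range] at hne
    obtain ⟨h1, h2, h3⟩ := hne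
    have h2 : |f (digitHistory Θ n ω)| < ε := by
      have h2 : f (digitHistory Θ n ω) ^ 2 < ε ^ 2 := not_le.1 h2
      exact abs_lt_of_sq_lt_sq h2 hε.le
    have h3 : ∑ m ∈ Finset.range n, w m * M m * ((Θ (m + 1) ω : ℝ) + 1)⁻¹ < ε := not_le.1 h3
    have hA : ∀ m ∈ Finset.range n, w m * (((Θ (m + 2) ω : ℝ) + 1) / (Θ (m + 1) ω + 1)) =
        g m (Θ (m + 1) ω) (Θ (m + 2) ω) := fun m hm => by
      have hm := Finset.mem_range.1 hm
      have h1 : g m (Θ (m + 1) ω) (Θ (m + 2) ω) ^ 2 < 1 := not_le.1 (h1 m hm)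
      simp only [hg, hm, if_true, truncatedRatio] at h1 ⊢
      rcases min_choice (w m * (((Θ (m + 2) ω : ℝ) + 1) / (Θ (m + 1) ω + 1))) 1 with h' | h'
      · exact h'.symm
      · rw [h'] at h1; norm_num at h1
    have hω : 2 * ε ≤ |∑ m ∈ Finset.range n,
        w m * (((Θ (m + 2) ω : ℝ) + 1) / (Θ (m + 1) ω + 1)) -
      ∑ m ∈ Finset.range n, w m * M m| := hω
    have hdec : ∑ m ∈ Finset.range n, w m * (((Θ (m + 2) ω : ℝ) + 1) / (Θ (m + 1) ω + 1)) -
        ∑ m ∈ Finset.range n, w m * M m = f (digitHistory Θ n ω) +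
          ∑ m ∈ Finset.range n, (G m (Θ (m + 1) ω) - w m * M m) := by
      rw [← hf ω, Finset.sum_congr rfl hA, Finset.sum_sub_distrib, Finset.sum_sub_distrib]
      ring
    have h4 : |∑ m ∈ Finset.range n, (G m (Θ (m + 1) ω) - w m * M m)| < ε := by
      refine (Finset.abs_sum_le_sum_abs _ _).trans_lt ((Finset.sum_le_sum fun m hm => ?_).trans_lt h3)
      have hm := Finset.mem_range.1 hm
      simp only [hG, hg, hm, if_true]
      exact (hF (m + 1) (by omega)).abs_integral_truncatedRatio_sub_le (hw m hm) _
    rw [hdec] at hω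
    have := abs_add_le (f (digitHistory Θ n ω))
      (∑ m ∈ Finset.range n, (G m (Θ (m + 1) ω) - w m * M m))
    linarith
  have hE1s : P.real (⋃ m ∈ Finset.range n, E1 m) ≤ (1 + 2 * C) * ∑ m ∈ Finset.range n, w m := by
    rw [Finset.mul_sum]
    exact (measureReal_biUnion_finset_le _ _).trans
      (Finset.sum_le_sum fun m hm => hE1 m (Finset.mem_range.1 hm))
  calc _ ≤ P.real ((⋃ m ∈ Finset.range n, E1 m) ∪ (E2 ∪ E3)) := measureReal_mono hsub
    _ ≤ P.real (⋃ m ∈ Finset.range n, E1 m) + (P.real E2 + P.real E3) :=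
      (measureReal_union_le _ _).trans (add_le_add_right (measureReal_union_le _ _) _)
    _ ≤ _ := by
      have : (1 + 2 * C) * (1 + 1 / ε ^ 2) * ∑ m ∈ Finset.range n, w m =
        (1 + 2 * C) * ∑ m ∈ Finset.range n, w m +
          1 / ε ^ 2 * ((1 + 2 * C) * ∑ m ∈ Finset.range n, w m) := by ring
      linarith

/-! ### Asymptotics of the centring constants. -/

theorem sum_Icc_one_eq_sum_range (f : ℕ → ℝ) (n : ℕ) :
    ∑ k ∈ Finset.Icc 1 n, f k = ∑ m ∈ Finset.range n, f (m + 1) := by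
  induction n with
  | zero => simp
  | succ n ih => rw [Finset.sum_Icc_succ_top (by omega), ih, Finset.sum_range_succ]

/-- x log x extends continuously to the compact interval [0, A]. -/
theorem exists_bound_mul_abs_log (A : ℝ) : ∃ L, ∀ x, 0 < x → x ≤ A → x * |Real.log x| ≤ L := by
  obtain ⟨L, hL⟩ := isCompact_Icc.exists_bound_of_continuousOn
    (s := Set.Icc 0 A) Real.continuous_mul_log.continuousOn
  refine ⟨L, fun x hx hxA => ?_⟩
  have := hL x ⟨hx.le, hxA⟩
  rwa [norm_mul, Real.norm_of_nonneg hx.le, Real.norm_eq_abs] at this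

/-- The centring constants of the truncated sums converge to `ℓ`, and the sum of the weights and
the accumulated bias vanish. -/
theorem WeightAssumptions.tendsto_truncated_means {α : ℕ → ℝ} {a : ℕ → ℕ → ℝ} {ρ : ℕ → ℝ} {ℓ : ℝ}
    (hW : WeightAssumptions α a ρ ℓ) {A : ℝ} (hA : ∀ n k, 1 ≤ k → k ≤ n → a k n ≤ A)
    {lo hi : ℝ} (hlo0 : 0 < lo) (hlo : ∀ n, 1 ≤ n → lo ≤ α n) (hhi : ∀ n, 1 ≤ n → α n ≤ hi)
    {M : ℕ → ℝ → ℝ} {K : ℝ}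
    (hM : ∀ n, 1 ≤ n → ∀ s, 0 < s → s ≤ 1 → |M n s - α n * Real.log s⁻¹| ≤ K)
    {r : ℝ} (hr0 : 0 ≤ r) (hr1 : r < 1) :
    (∀ᶠ n in atTop, ∀ m < n, 0 < a (m + 1) n / (ρ n * Real.log n) ∧
      a (m + 1) n / (ρ n * Real.log n) ≤ 1) ∧
    Tendsto (fun n => ∑ m ∈ Finset.range n, a (m + 1) n / (ρ n * Real.log n)) atTop (𝓝 0) ∧
    Tendsto (fun n => ∑ m ∈ Finset.range n, a (m + 1) n / (ρ n * Real.log n) *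
      M (m + 1) (a (m + 1) n / (ρ n * Real.log n))) atTop (𝓝 ℓ) ∧
    (∃ u : ℕ → ℝ, Tendsto u atTop (𝓝 0) ∧
      ∀ᶠ n in atTop, ∑ m ∈ Finset.range n, a (m + 1) n / (ρ n * Real.log n) *
        M (m + 1) (a (m + 1) n / (ρ n * Real.log n)) * r ^ m ≤ u n) := by
  set c : ℕ → ℝ := fun n => ρ n * Real.log n with hc
  have hct : Tendsto c atTop atTop := hW.tendsto_norm
  have hpos : ∀ n, ∀ m < n, 0 < a (m + 1) n := fun n m hm => hW.pos n (m + 1) (by omega) (by omega)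
  have hAm : ∀ n, ∀ m < n, a (m + 1) n ≤ A := fun n m hm => hA n (m + 1) (by omega) (by omega)
  obtain ⟨S, hS⟩ := hW.bounded
  obtain ⟨L, hL⟩ := exists_bound_mul_abs_log A
  have hinv : Tendsto (fun n => 1 / c n) atTop (𝓝 0) := by
    simp only [one_div]
    exact hct.inv_tendsto_atTop
  have hlog : Tendsto (fun n => Real.log (c n) / c n) atTop (𝓝 0) :=
    (Real.isLittleO_log_id_atTop.tendsto_div_nhds_zero).comp hct
  have hev : ∀ᶠ n in atTop, 1 ≤ c n ∧ A ≤ c n ∧ 1 ≤ n :=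
    (hct.eventually_ge_atTop 1).and ((hct.eventually_ge_atTop A).and (eventually_ge_atTop 1))
  have hw : ∀ᶠ n in atTop, ∀ m < n, 0 < a (m + 1) n / c n ∧ a (m + 1) n / c n ≤ 1 := by
    filter_upwards [hev] with n hn m hm
    have h0 : 0 < c n := by linarith [hn.1]
    exact ⟨div_pos (hpos n m hm) h0, (div_le_one₀ h0).2 ((hAm n m hm).trans hn.2.1)⟩
  have hbS : ∀ n, 1 ≤ n → ∑ m ∈ Finset.range n, α (m + 1) * a (m + 1) n ≤ S := fun n hn => by
    rw [← sum_Icc_one_eq_sum_range fun k => α k * a k n]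
    exact (le_abs_self _).trans (hS n hn)
  have hαpos : ∀ m, 0 < α (m + 1) := fun m => hlo0.trans_le (hlo _ (by omega))
  have hb0 : ∀ n, ∀ m < n, 0 < α (m + 1) * a (m + 1) n := fun n m hm =>
    mul_pos (hαpos m) (hpos n m hm)
  have haS : ∀ n, 1 ≤ n → ∑ m ∈ Finset.range n, a (m + 1) n ≤ S / lo := fun n hn => by
    rw [le_div_iff₀ hlo0, Finset.sum_mul]
    refine (Finset.sum_le_sum fun m hm => ?_).trans (hbS n hn)
    rw [mul_comm]
    exact mul_le_mul_of_nonneg_right (hlo _ (by omega)) (hpos n m (Finset.mem_range.1 hm)).le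
  have hsum : Tendsto (fun n => ∑ m ∈ Finset.range n, a (m + 1) n / c n) atTop (𝓝 0) := by
    refine squeeze_zero' (g := fun n => S / lo * (1 / c n)) ?_ ?_
      (by simpa using hinv.const_mul (S / lo))
    · filter_upwards [hw] with n hn
      exact Finset.sum_nonneg fun m hm => (hn m (Finset.mem_range.1 hm)).1.le
    · filter_upwards [hev] with n hn
      have h0 : 0 < c n := by linarith [hn.1]
      rw [← Finset.sum_div, div_eq_mul_one_div]
      exact mul_le_mul_of_nonneg_right (haS n hn.2.2) (by positivity)
  refine ⟨hw, hsum, ?_, ?_⟩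
  · set L' : ℝ := max |Real.log lo| |Real.log hi|
    have hL' : ∀ m, |Real.log (α (m + 1))| ≤ L' := fun m => by
      have h1 := Real.log_le_log hlo0 (hlo (m + 1) (by omega))
      have h2 := Real.log_le_log (hαpos m) (hhi (m + 1) (by omega))
      exact abs_le_max_abs_abs h1 h2
    have hK0 : 0 ≤ K := (abs_nonneg _).trans (hM 1 le_rfl 1 one_pos le_rfl)
    have hent := hW.tendsto_entropy.neg
    rw [neg_neg] at hent
    have hdiff : Tendsto (fun n => ∑ m ∈ Finset.range n, a (m + 1) n / c n *
        M (m + 1) (a (m + 1) n / c n) -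
        -((∑ k ∈ Finset.Icc 1 n, α k * a k n * Real.log (α k * a k n)) / (ρ n * Real.log n)))
        atTop (𝓝 0) := by
      refine squeeze_zero_norm' (a := fun n => K * ∑ m ∈ Finset.range n, a (m + 1) n / c n +
        (S * (Real.log (c n) / c n) + L' * S * (1 / c n))) ?_ ?_
      · filter_upwards [hev, hw] with n hn hwn
        have h0 : 0 < c n := by linarith [hn.1]
        have hlc : 0 ≤ Real.log (c n) := Real.log_nonneg hn.1
        rw [sum_Icc_one_eq_sum_range fun k => α k * a k n * Real.log (α k * a k n),
          sub_neg_eq_add, Finset.sum_div, ← Finset.sum_add_distrib, Real.norm_eq_abs]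
        calc _ ≤ ∑ m ∈ Finset.range n, (K * (a (m + 1) n / c n) +
              (α (m + 1) * a (m + 1) n * (Real.log (c n) / c n) +
                L' * (α (m + 1) * a (m + 1) n) * (1 / c n))) := by
              refine (Finset.abs_sum_le_sum_abs _ _).trans (Finset.sum_le_sum fun m hm => ?_)
              have hm := Finset.mem_range.1 hm
              have ham := hpos n m hm
              have hαm := hαpos m
              obtain ⟨hw0, hw1⟩ := hwn m hm
              have e1 : Real.log (a (m + 1) n / c n)⁻¹ = Real.log (c n) - Real.log (a (m + 1) n) := by
                rw [inv_div, Real.log_div h0.ne' ham.ne']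
              have e2 : Real.log (α (m + 1) * a (m + 1) n) =
                  Real.log (α (m + 1)) + Real.log (a (m + 1) n) := Real.log_mul hαm.ne' ham.ne'
              have hMm := hM (m + 1) (by omega) _ hw0 hw1
              rw [e1] at hMm
              -- The term plus its entropy counterpart splits into the error of M (at most K w), a
              -- multiple of log c / c, and the cost of log(α a) against log a; all three sum to
              -- o(1).
              have e3 : a (m + 1) n / c n * M (m + 1) (a (m + 1) n / c n) +
                  α (m + 1) * a (m + 1) n * Real.log (α (m + 1) * a (m + 1) n) / (ρ n * Real.log n) =
                  a (m + 1) n / c n * (M (m + 1) (a (m + 1) n / c n) -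
                    α (m + 1) * (Real.log (c n) - Real.log (a (m + 1) n))) +
                  (α (m + 1) * a (m + 1) n * (Real.log (c n) / c n) +
                    Real.log (α (m + 1)) * (α (m + 1) * a (m + 1) n) * (1 / c n)) := by
                rw [e2, show ρ n * Real.log n = c n from rfl]
                field_simp
                ring
              rw [e3]
              refine (abs_add_le _ _).trans (add_le_add ?_ ((abs_add_le _ _).trans
                (add_le_add ?_ ?_)))
              · rw [abs_mul, abs_of_pos hw0, mul_comm]
                exact mul_le_mul_of_nonneg_right hMm hw0.le
              · exact (abs_of_nonneg (by positivity)).le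
              · rw [abs_mul, abs_mul, abs_of_pos (hb0 n m hm), abs_of_pos (by positivity : 0 < 1 / c n)]
                have := hL' m
                have := hb0 n m hm
                gcongr
          _ = K * ∑ m ∈ Finset.range n, a (m + 1) n / c n +
              ((∑ m ∈ Finset.range n, α (m + 1) * a (m + 1) n) * (Real.log (c n) / c n) +
                L' * (∑ m ∈ Finset.range n, α (m + 1) * a (m + 1) n) * (1 / c n)) := by
              rw [Finset.sum_add_distrib, Finset.sum_add_distrib, ← Finset.mul_sum,
                ← Finset.sum_mul, ← Finset.sum_mul, ← Finset.mul_sum]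
          _ ≤ _ := by
              have := hbS n hn.2.2
              have : 0 ≤ L' := (abs_nonneg _).trans (le_max_left _ _)
              gcongr
      · simpa using (hsum.const_mul K).add ((hlog.const_mul S).add (hinv.const_mul (L' * S)))
    simpa using hdiff.add hent
  -- The factor before (1 - r)⁻¹ bounds every single w M uniformly in m, using a ≤ A and a |log a| ≤
  -- L; the geometric weights then sum to at most (1 - r)⁻¹.
  · refine ⟨fun n => (K * A * (1 / c n) + (hi * A * (Real.log (c n) / c n) + hi * L * (1 / c n))) *
      (1 - r)⁻¹, ?_, ?_⟩
    · simpa using ((hinv.const_mul (K * A)).add ((hlog.const_mul (hi * A)).add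
        (hinv.const_mul (hi * L)))).mul_const (1 - r)⁻¹
    · filter_upwards [hev, hw] with n hn hwn
      have h0 : 0 < c n := by linarith [hn.1]
      have hlc : 0 ≤ Real.log (c n) := Real.log_nonneg hn.1
      have hA0 : 0 ≤ A := (hpos n 0 hn.2.2).le.trans (hAm n 0 hn.2.2)
      have hhi0 : 0 ≤ hi := (hαpos 0).le.trans (hhi 1 le_rfl)
      have hK0 : 0 ≤ K := (abs_nonneg _).trans (hM 1 le_rfl 1 one_pos le_rfl)
      have hL0 : 0 ≤ L :=
        (mul_nonneg (hpos n 0 hn.2.2).le (abs_nonneg _)).trans (hL _ (hpos n 0 hn.2.2) (hAm n 0 hn.2.2))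
      set Q := K * A * (1 / c n) + (hi * A * (Real.log (c n) / c n) + hi * L * (1 / c n)) with hQ
      have hQ0 : 0 ≤ Q := by positivity
      have hterm : ∀ m < n, a (m + 1) n / c n * M (m + 1) (a (m + 1) n / c n) ≤ Q := fun m hm => by
        have ham := hpos n m hm
        have hαm := hαpos m
        obtain ⟨hw0, hw1⟩ := hwn m hm
        have e1 : Real.log (a (m + 1) n / c n)⁻¹ = Real.log (c n) - Real.log (a (m + 1) n) := by
          rw [inv_div, Real.log_div h0.ne' ham.ne']
        have hMm := hM (m + 1) (by omega) _ hw0 hw1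
        rw [e1] at hMm
        have hMle : M (m + 1) (a (m + 1) n / c n) ≤
            K + hi * (Real.log (c n) + |Real.log (a (m + 1) n)|) := by
          have h1 := (abs_le.1 hMm).2
          have h2 : α (m + 1) * (Real.log (c n) - Real.log (a (m + 1) n)) ≤
              hi * (Real.log (c n) + |Real.log (a (m + 1) n)|) := by
            have := hhi (m + 1) (by omega)
            have h3 := neg_abs_le (Real.log (a (m + 1) n))
            calc _ ≤ α (m + 1) * (Real.log (c n) + |Real.log (a (m + 1) n)|) := by
                  gcongr; linarith
              _ ≤ _ := by gcongr
          linarith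
        calc _ ≤ a (m + 1) n / c n * (K + hi * (Real.log (c n) + |Real.log (a (m + 1) n)|)) := by
              gcongr
          _ = K * a (m + 1) n * (1 / c n) + (hi * a (m + 1) n * (Real.log (c n) / c n) +
              hi * (a (m + 1) n * |Real.log (a (m + 1) n)|) * (1 / c n)) := by field_simp
          _ ≤ Q := by
              have := hAm n m hm
              have := hL _ ham this
              rw [hQ]
              gcongr
      calc _ ≤ ∑ m ∈ Finset.range n, Q * r ^ m := Finset.sum_le_sum fun m hm =>
            mul_le_mul_of_nonneg_right (hterm m (Finset.mem_range.1 hm)) (pow_nonneg hr0 m)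
        _ = Q * ∑ m ∈ Finset.range n, r ^ m := by rw [Finset.mul_sum]
        _ ≤ Q * (1 - r)⁻¹ := by
            refine mul_le_mul_of_nonneg_left ?_ hQ0
            rw [← tsum_geometric_of_lt_one hr0 hr1]
            exact (summable_geometric_of_lt_one hr0 hr1).sum_le_tsum _ fun m _ => pow_nonneg hr0 m

/-! ### Weak law, and uniform constants from conditions (i) and (ii). -/

/-- Weak law for the Engel scheme under explicit uniform tail bounds. -/
theorem IsEngelSequence.tendstoInMeasure_of_uniform_bounds
    {Ω : Type*} [MeasurableSpace Ω] {P : Measure Ω} [IsProbabilityMeasure P]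
    {F : ℕ → StieltjesFunction ℝ} {D : ℕ → Ω → ℕ} (hD : IsEngelSequence P F D)
    (hF : ∀ n, 1 ≤ n → IsUnitDistribution (F n))
    {α : ℕ → ℝ} {a : ℕ → ℕ → ℝ} {ρ : ℕ → ℝ} {ℓ : ℝ}
    (hW : WeightAssumptions α a ρ ℓ) {A : ℝ} (hA : ∀ n k, 1 ≤ k → k ≤ n → a k n ≤ A)
    {lo hi : ℝ} (hlo0 : 0 < lo) (hlo : ∀ n, 1 ≤ n → lo ≤ α n) (hhi : ∀ n, 1 ≤ n → α n ≤ hi)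
    {p C K : ℝ} (hp0 : 0 < p)
    (hp : ∀ n, 1 ≤ n → p ≤ F n (1 / 2)) (hC : ∀ n, 1 ≤ n → ∀ t, 0 < t → F n t ≤ C * t)
    (hK : ∀ n, 1 ≤ n → ∀ s, 0 < s → s ≤ 1 →
      |∫ u, (max u s)⁻¹ ∂(F n).measure - α n * Real.log s⁻¹| ≤ K) :
    TendstoInMeasure P
      (fun (n : ℕ) (ω : Ω) => 1 / (ρ n * Real.log n) *
        ∑ k ∈ Finset.Icc 1 n, a k n * ((D (k + 1) ω : ℝ) / (D k ω : ℝ)))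
      atTop (fun _ => ℓ) := by
  set Θ : ℕ → Ω → ℕ := fun n ω => D n ω - 1 with hΘ
  have h : IsOppenheimSequence P F (fun _ h => (h : ℝ)) (fun _ _ => 0) Θ := hD
  -- The subtraction in Θ is truncated; D = Θ + 1 holds because Θ ≥ 1 almost surely.
  have hae : ∀ᵐ ω ∂P, ∀ n, 1 ≤ n → (D n ω : ℝ) = Θ n ω + 1 := by
    rw [ae_all_iff]; intro n
    by_cases hn : 1 ≤ n
    · filter_upwards [h.pos n hn] with ω hω _
      have : D n ω = Θ n ω + 1 := by simp only [hΘ] at hω ⊢; omega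
      exact_mod_cast this
    · exact Eventually.of_forall fun ω h' => absurd h' hn
  refine TendstoInMeasure.congr_left (f := fun (n : ℕ) (ω : Ω) => ∑ m ∈ Finset.range n,
    a (m + 1) n / (ρ n * Real.log n) * (((Θ (m + 2) ω : ℝ) + 1) / (Θ (m + 1) ω + 1)))
    (fun n => ?_) ?_
  · filter_upwards [hae] with ω hω
    rw [sum_Icc_one_eq_sum_range fun k => a k n * ((D (k + 1) ω : ℝ) / (D k ω : ℝ)),
      Finset.mul_sum]
    refine Finset.sum_congr rfl fun m _ => ?_
    rw [hω (m + 1 + 1) (by omega), hω (m + 1) (by omega)]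
    ring
  have hp1 : p ≤ 1 := (hp 1 le_rfl).trans ((hF 1 le_rfl).le_one _)
  obtain ⟨hw, hsum, hmean, u, hu0, hu⟩ := hW.tendsto_truncated_means hA hlo0 hlo hhi
    (M := fun n s => ∫ u, (max u s)⁻¹ ∂(F n).measure) hK (r := 1 - p / 3) (by linarith) (by linarith)
  rw [tendstoInMeasure_iff_measureReal_norm]
  intro ε hε
  -- Two thirds of ε go to the random deviation, one third to the distance of the centring from ℓ.
  have hε3 : 0 < ε / 3 := by positivity
  have hlim : Tendsto (fun n => (1 + 2 * C) * (1 + 1 / (ε / 3) ^ 2) *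
      ∑ m ∈ Finset.range n, a (m + 1) n / (ρ n * Real.log n) + 1 / (ε / 3) * u n)
      atTop (𝓝 0) := by
    have := (hsum.const_mul ((1 + 2 * C) * (1 + 1 / (ε / 3) ^ 2))).add
      (hu0.const_mul (1 / (ε / 3)))
    rwa [mul_zero, mul_zero, add_zero] at this
  refine squeeze_zero' (Eventually.of_forall fun n => measureReal_nonneg) ?_ hlim
  filter_upwards [hw, hu, Metric.tendsto_nhds.1 hmean (ε / 3) hε3] with n hwn hun hmn
  have hdev := h.measureReal_sum_ratio_sub_ge_le hF hp hC
    (w := fun m => a (m + 1) n / (ρ n * Real.log n))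
    (fun m hm => (hwn m hm).1) (fun m hm => (hwn m hm).2) hε3
  refine (measureReal_mono ?_).trans (hdev.trans ?_)
  · intro ω hω
    rw [Real.dist_eq] at hmn
    have hω : ε ≤ |_ - ℓ| := hω
    refine Set.mem_ofPred_eq.mpr ?_
    have := abs_sub_le (∑ m ∈ Finset.range n,
      a (m + 1) n / (ρ n * Real.log n) * (((Θ (m + 2) ω : ℝ) + 1) / (Θ (m + 1) ω + 1)))
      (∑ m ∈ Finset.range n, a (m + 1) n / (ρ n * Real.log n) *
        ∫ u, (max u (a (m + 1) n / (ρ n * Real.log n)))⁻¹ ∂(F (m + 1)).measure) ℓ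
    linarith
  · have := mul_le_mul_of_nonneg_left hun (by positivity : 0 ≤ 1 / (ε / 3))
    linarith

/-- Both quantities are integrals over (s, 1); their difference is 1 plus the integral of (1 / v)
(F(v) / v - α), which condition (ii) controls uniformly in s. -/
theorem IsUnitDistribution.abs_integral_inv_max_sub_log_le {F : StieltjesFunction ℝ}
    (hF : IsUnitDistribution F) {α K : ℝ} (hK0 : 0 ≤ K)
    (hK : ∫⁻ u in Set.Ioo 0 1, ENNReal.ofReal (1 / u * |F u / u - α|) ≤ ENNReal.ofReal K)
    {s : ℝ} (hs : 0 < s) (hs1 : s ≤ 1) :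
    |∫ u, (max u s)⁻¹ ∂F.measure - α * Real.log s⁻¹| ≤ 1 + K := by
  have h0 : ∀ v ∈ Set.uIcc s 1, v ≠ 0 := fun v hv => by
    rw [Set.uIcc_of_le hs1] at hv; exact (hs.trans_le hv.1).ne'
  have hlog : α * Real.log s⁻¹ = ∫ v in s..1, α * v⁻¹ := by
    rw [intervalIntegral.integral_const_mul, integral_inv_of_pos hs one_pos, one_div]
  have hi1 : IntervalIntegrable (fun v => F v / v ^ 2) volume s 1 := by
    simp only [div_eq_mul_inv]
    exact F.mono.intervalIntegrable.mul_continuousOn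
      (ContinuousOn.inv₀ (by fun_prop) fun v hv => pow_ne_zero _ (h0 v hv))
  have hi2 : IntervalIntegrable (fun v => α * v⁻¹) volume s 1 :=
    ContinuousOn.intervalIntegrable (continuousOn_const.mul
      (ContinuousOn.inv₀ continuousOn_id h0))
  rw [hF.integral_inv_max hs hs1, hlog, add_sub_assoc, ← intervalIntegral.integral_sub hi1 hi2]
  refine (abs_add_le _ _).trans ?_
  rw [abs_one]
  gcongr
  rw [intervalIntegral.integral_of_le hs1, integral_Ioc_eq_integral_Ioo, ← Real.norm_eq_abs]
  refine (norm_integral_le_lintegral_norm _).trans (ENNReal.toReal_le_of_le_ofReal hK0 (le_trans ?_ hK))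
  calc _ = ∫⁻ u in Set.Ioo s 1, ENNReal.ofReal (1 / u * |F u / u - α|) := by
        refine setLIntegral_congr_fun measurableSet_Ioo fun v hv => ?_
        have hv0 : 0 < v := hs.trans hv.1
        have : F v / v ^ 2 - α * v⁻¹ = 1 / v * (F v / v - α) := by field_simp
        simp only [this, Real.norm_eq_abs, abs_mul, abs_of_pos (one_div_pos.2 hv0)]
    _ ≤ _ := lintegral_mono_set (Set.Ioo_subset_Ioo_left hs.le)

theorem exists_forall_le_of_limsup_lt_top {α : ℕ → ℝ}
    (h : limsup (fun n => (α n : EReal)) atTop < ⊤) : ∃ B, ∀ n, α n ≤ B := by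
  obtain ⟨b, hb, -⟩ := EReal.lt_iff_exists_real_btwn.1 h
  have hev : ∀ᶠ n in atTop, α n ≤ b :=
    (eventually_lt_of_limsup_lt hb).mono fun n hn => (EReal.coe_lt_coe_iff.1 hn).le
  obtain ⟨B, hB⟩ := (isBoundedUnder_of_eventually_le hev).bddAbove_range
  exact ⟨B, fun n => hB ⟨n, rfl⟩⟩

/-- Passing to inverses turns the lower bound into an upper one, where the finitely many exceptional
terms are absorbed. -/
theorem exists_pos_forall_le_of_liminf_pos {α : ℕ → ℝ} (hpos : ∀ n, 1 ≤ n → 0 < α n)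
    (h : 0 < liminf (fun n => (α n : EReal)) atTop) : ∃ b, 0 < b ∧ ∀ n, 1 ≤ n → b ≤ α n := by
  obtain ⟨b, hb0, hb⟩ := EReal.lt_iff_exists_real_btwn.1 h
  have hb0 : 0 < b := by exact_mod_cast hb0
  have hev : ∀ᶠ n in atTop, (α n)⁻¹ ≤ b⁻¹ :=
    (eventually_lt_of_lt_liminf hb).mono fun n hn => inv_anti₀ hb0 (EReal.coe_lt_coe_iff.1 hn).le
  obtain ⟨B, hB⟩ := (isBoundedUnder_of_eventually_le hev).bddAbove_range
  refine ⟨(max B 1)⁻¹, by positivity, fun n hn => ?_⟩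
  rw [inv_le_comm₀ (by positivity) (hpos n hn)]
  exact (hB ⟨n, rfl⟩ : (α n)⁻¹ ≤ B).trans (le_max_left _ _)

theorem exists_forall_abs_div_sub_lt {F : ℕ → StieltjesFunction ℝ} {α : ℕ → ℝ}
    (h : ConditionI F α) {η : ℝ} (hη : 0 < η) :
    ∃ δ, 0 < δ ∧ ∀ t, 0 < t → t < δ → ∀ n, 1 ≤ n → |F n t / t - α n| < η := by
  have := h.tendsto_sup.eventually_lt_const (ENNReal.ofReal_pos.2 hη)
  obtain ⟨δ, hδ, hsub⟩ := (mem_nhdsGT_iff_exists_Ioo_subset).1 this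
  refine ⟨δ, hδ, fun t ht htδ n hn => ?_⟩
  have h1 : ⨆ n : ℕ, ⨆ _ : 1 ≤ n, ENNReal.ofReal |F n t / t - α n| < ENNReal.ofReal η :=
    hsub ⟨ht, htδ⟩
  exact (ENNReal.ofReal_lt_ofReal_iff hη).1 (lt_of_le_of_lt (le_iSup₂_of_le n hn le_rfl) h1)

theorem IsEngelSequence.tendstoInMeasure {Ω : Type*} [MeasurableSpace Ω] {P : Measure Ω}
    [IsProbabilityMeasure P] {F : ℕ → StieltjesFunction ℝ} {D : ℕ → Ω → ℕ}
    (hD : IsEngelSequence P F D) (hF : ∀ n, 1 ≤ n → IsUnitDistribution (F n))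
    {α : ℕ → ℝ} (hI : ConditionI F α) (hII : ConditionII F α)
    {a : ℕ → ℕ → ℝ} {ρ : ℕ → ℝ} {ℓ : ℝ} (hW : WeightAssumptions α a ρ ℓ) {A : ℝ}
    (hA : ∀ n k, 1 ≤ k → k ≤ n → a k n ≤ A) :
    TendstoInMeasure P
      (fun (n : ℕ) (ω : Ω) => 1 / (ρ n * Real.log n) *
        ∑ k ∈ Finset.Icc 1 n, a k n * ((D (k + 1) ω : ℝ) / (D k ω : ℝ)))
      atTop (fun _ => ℓ) := by
  obtain ⟨hi, hhi⟩ := exists_forall_le_of_limsup_lt_top hI.limsup_lt_top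
  obtain ⟨lo, hlo0, hlo⟩ := exists_pos_forall_le_of_liminf_pos hI.pos hI.liminf_pos
  have hhi0 : 0 < hi := hlo0.trans_le ((hlo 1 le_rfl).trans (hhi 1))
  obtain ⟨δ, hδ, hFδ⟩ := exists_forall_abs_div_sub_lt hI (half_pos hlo0)
  obtain ⟨τ, hτ, hIIτ⟩ : ∃ τ, 0 < τ ∧ ∀ n, 1 ≤ n →
      ∫⁻ u in Set.Ioo 0 τ, ENNReal.ofReal (1 / u * |F n u / u - α n|) ≤ 1 := by
    obtain ⟨τ, hτ, hτ'⟩ := ((hII.eventually_lt_const one_pos).and self_mem_nhdsWithin).exists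
    exact ⟨τ, hτ', fun n hn => (le_iSup₂_of_le (f := fun (n : ℕ) (_ : 1 ≤ n) =>
      ∫⁻ u in Set.Ioo 0 τ, ENNReal.ofReal (1 / u * |F n u / u - α n|)) n hn le_rfl).trans hτ.le⟩
  -- The first two summands serve t < δ by condition (i); 1 / δ serves t ≥ δ, where F ≤ 1.
  set C := hi + lo / 2 + 1 / δ with hCdef
  have hC : ∀ n, 1 ≤ n → ∀ t, 0 < t → F n t ≤ C * t := fun n hn t ht => by
    rcases lt_or_ge t δ with h | h
    · have h1 := (abs_lt.1 (hFδ t ht h n hn)).2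
      have h2 : F n t / t ≤ C := by
        have := hhi n
        have : 0 < 1 / δ := by positivity
        linarith
      exact (div_le_iff₀ ht).1 h2
    · refine ((hF n hn).le_one t).trans ?_
      have h1 : 1 ≤ 1 / δ * t := by rw [one_div, ← div_eq_inv_mul]; exact (one_le_div₀ hδ).2 h
      have : 0 ≤ (hi + lo / 2) * t := by positivity
      rw [hCdef, add_mul]
      linarith
  -- Small enough for condition (i) and at most 1/2, so that F(1/2) ≥ F(t₀) ≥ (lo / 2) t₀.
  set t₀ := min (δ / 2) (1 / 2)
  have ht₀ : 0 < t₀ := by positivity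
  -- In K, the outer 1 is the boundary term of Tonelli's formula, the inner 1 bounds the integral
  -- over (0, τ), and the rest the integral over [τ, 1).
  refine hD.tendstoInMeasure_of_uniform_bounds hF hW hA hlo0 hlo (fun n _ => hhi n)
    (p := lo / 2 * t₀) (C := C) (K := 1 + (1 + 1 / τ * (C + hi))) (by positivity) ?_ hC ?_
  · intro n hn
    have h1 := (abs_lt.1 (hFδ t₀ ht₀ ((min_le_left _ _).trans_lt (half_lt_self hδ)) n hn)).1
    have h2 : lo / 2 ≤ F n t₀ / t₀ := by have := hlo n hn; linarith
    exact ((le_div_iff₀ ht₀).1 h2).trans ((F n).mono (min_le_right _ _))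
  · intro n hn s hs hs1
    have hC0 : 0 ≤ C := by positivity
    refine (hF n hn).abs_integral_inv_max_sub_log_le (by positivity) ?_ hs hs1
    have hsub : Set.Ioo (0 : ℝ) 1 ⊆ Set.Ioo 0 τ ∪ Set.Ico τ 1 := fun u hu => by
      rcases lt_or_ge u τ with h | h
      · exact Or.inl ⟨hu.1, h⟩
      · exact Or.inr ⟨h, hu.2⟩
    have hbd : ∀ u ∈ Set.Ico τ 1, ENNReal.ofReal (1 / u * |F n u / u - α n|) ≤
        ENNReal.ofReal (1 / τ * (C + hi)) := fun u hu => by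
      have hu0 : 0 < u := hτ.trans_le hu.1
      refine ENNReal.ofReal_le_ofReal ?_
      have h1 : |F n u / u - α n| ≤ C + hi := by
        have h2 : F n u / u ≤ C := (div_le_iff₀ hu0).2 (hC n hn u hu0)
        have h3 : 0 ≤ F n u / u := div_nonneg ((hF n hn).nonneg u) hu0.le
        have h4 := hhi n
        have h5 := hI.pos n hn
        rw [abs_le]; constructor <;> linarith
      have := hu.1
      gcongr
    have hvol : volume (Set.Ico τ 1) ≤ 1 := by
      rw [Real.volume_Ico]
      exact ENNReal.ofReal_le_one.2 (by linarith)
    calc _ ≤ ∫⁻ u in Set.Ioo 0 τ ∪ Set.Ico τ 1, ENNReal.ofReal (1 / u * |F n u / u - α n|) :=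
          lintegral_mono_set hsub
      _ ≤ _ := lintegral_union_le _ _ _
      _ ≤ 1 + ∫⁻ u in Set.Ico τ 1, ENNReal.ofReal (1 / τ * (C + hi)) :=
          add_le_add (hIIτ n hn) (setLIntegral_mono measurable_const hbd)
      _ ≤ 1 + ENNReal.ofReal (1 / τ * (C + hi)) := by
          rw [setLIntegral_const]
          exact add_le_add_right (mul_le_of_le_one_right' hvol) _
      _ = _ := by
          rw [ENNReal.ofReal_add zero_le_one (by positivity), ENNReal.ofReal_one]

/-! ### The Engel series under Lebesgue measure. -/

/-- The distribution function of the uniform law on `[0, 1]`. -/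
noncomputable def uniformDistribution : StieltjesFunction ℝ where
  toFun t := max 0 (min t 1)
  mono' _ _ h := max_le_max_left _ (min_le_min_right _ h)
  right_continuous' _ := by
    have : Continuous fun t : ℝ => max 0 (min t 1) := by fun_prop
    exact this.continuousWithinAt

theorem uniformDistribution_apply (t : ℝ) : uniformDistribution t = max 0 (min t 1) := rfl

theorem uniformDistribution_of_mem {t : ℝ} (h0 : 0 ≤ t) (h1 : t ≤ 1) :
    uniformDistribution t = t := by
  rw [uniformDistribution_apply, min_eq_left h1, max_eq_right h0]

theorem isUnitDistribution_uniformDistribution : IsUnitDistribution uniformDistribution where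
  eq_zero t ht := by
    rw [uniformDistribution_apply]; exact max_eq_left ((min_le_left _ _).trans ht)
  eq_one t ht := by
    rw [uniformDistribution_apply, min_eq_right ht]; exact max_eq_right zero_le_one

theorem engelRemainder_mem {x : ℝ} (hx : x ∈ Set.Ioc (0 : ℝ) 1) (n : ℕ) :
    engelRemainder x n ∈ Set.Ioc (0 : ℝ) 1 := by
  induction n with
  | zero => exact hx
  | succ n ih =>
    obtain ⟨h0, h1⟩ := ih
    set y := engelRemainder x n
    have h2 : 1 / y * y = 1 := one_div_mul_cancel h0.ne'
    have h3 : (⌊1 / y⌋₊ : ℝ) ≤ 1 / y := Nat.floor_le (by positivity)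
    have h4 : 1 / y < ⌊1 / y⌋₊ + 1 := Nat.lt_floor_add_one _
    change ((⌊1 / y⌋₊ + 1 : ℕ) : ℝ) * y - 1 ∈ _
    push_cast
    constructor <;> nlinarith

theorem measurable_engelRemainder (n : ℕ) : Measurable fun x => engelRemainder x n := by
  induction n with
  | zero => exact measurable_id
  | succ n ih =>
    have h1 : Measurable fun x => ⌊1 / engelRemainder x n⌋₊ :=
      Nat.measurable_floor.comp (measurable_const.div ih)
    have h2 : Measurable fun x => ((⌊1 / engelRemainder x n⌋₊ + 1 : ℕ) : ℝ) :=
      (measurable_of_countable fun k : ℕ => ((k + 1 : ℕ) : ℝ)).comp h1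
    exact (h2.mul ih).sub_const 1

theorem floor_one_div_eq_iff {u : ℝ} (hu : 0 < u) {k : ℕ} (hk : 1 ≤ k) :
    ⌊1 / u⌋₊ = k ↔ 1 / ((k : ℝ) + 1) < u ∧ u ≤ 1 / k := by
  have hk0 : (0 : ℝ) < k := by exact_mod_cast hk
  rw [Nat.floor_eq_iff (by positivity), le_one_div hk0 hu, one_div_lt hu (by positivity), and_comm]

/-- On a cylinder of digits, the remainder is uniformly distributed on `(0, 1 / hₙ]`. -/
theorem exists_volume_engel_cylinder (h : ℕ → ℕ) (h0 : h 0 = 1) (n : ℕ)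
    (hmono : ∀ j < n, h j ≤ h (j + 1)) :
    1 ≤ h n ∧ ∃ s : ℝ, 0 < s ∧ ∀ B : Set ℝ, MeasurableSet B →
      volume (Set.Ioc 0 1 ∩ {x | (∀ j < n, ⌊1 / engelRemainder x j⌋₊ = h (j + 1)) ∧
        engelRemainder x n ∈ B}) = ENNReal.ofReal s * volume (B ∩ Set.Ioc 0 (1 / (h n : ℝ))) := by
  induction n with
  | zero =>
    refine ⟨h0.ge, 1, one_pos, fun B _ => ?_⟩
    simp only [h0, ENNReal.ofReal_one, one_mul, Nat.cast_one, div_one, Set.inter_comm B]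
    congr 1
    ext x
    simp [engelRemainder]
  | succ n ih =>
    obtain ⟨hn, s, hs, hvol⟩ := ih fun j hj => hmono j (by omega)
    have hle := hmono n (by omega)
    set k := h (n + 1)
    have hk : 1 ≤ k := hn.trans hle
    have hk0 : (0 : ℝ) < (k : ℝ) := by exact_mod_cast hk
    -- The next remainder is (k + 1) u - 1 on the block (1 / (k + 1), 1 / k]. This affine map
    -- carries the block onto (0, 1 / k] and scales length by k + 1; the block lies in (0, 1 / hₙ]
    -- since hₙ ≤ k.
    refine ⟨hk, s * ((k : ℝ) + 1)⁻¹, by positivity, fun B hB => ?_⟩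
    set B' : Set ℝ := {u | ⌊1 / u⌋₊ = k ∧ ((k : ℝ) + 1) * u + -1 ∈ B} with hB'
    have hB'm : MeasurableSet B' := by
      refine MeasurableSet.inter ?_ ?_
      · exact (Nat.measurable_floor.comp (measurable_const.div measurable_id))
          (measurableSet_singleton k)
      · exact (by fun_prop : Measurable fun u : ℝ => ((k : ℝ) + 1) * u + -1) hB
    have hset : {x : ℝ | (∀ j < n + 1, ⌊1 / engelRemainder x j⌋₊ = h (j + 1)) ∧
        engelRemainder x (n + 1) ∈ B} =
        {x | (∀ j < n, ⌊1 / engelRemainder x j⌋₊ = h (j + 1)) ∧ engelRemainder x n ∈ B'} := by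
      ext x
      have hrem : engelRemainder x (n + 1) =
          ((⌊1 / engelRemainder x n⌋₊ + 1 : ℕ) : ℝ) * engelRemainder x n - 1 := rfl
      simp only [Set.mem_ofPred_eq, Nat.forall_lt_succ_right, hB', and_assoc, hrem]
      refine and_congr_right fun _ => and_congr_right fun hx => ?_
      rw [show ⌊1 / engelRemainder x n⌋₊ = k from hx]
      push_cast
      rw [← sub_eq_add_neg]
    have hB'eq : B' ∩ Set.Ioc 0 (1 / (h n : ℝ)) =
        (fun u => ((k : ℝ) + 1) * u) ⁻¹' ((fun u => u + -1) ⁻¹' (B ∩ Set.Ioc 0 (1 / (k : ℝ)))) := by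
      ext u
      have hnk : 1 / (k : ℝ) ≤ 1 / (h n : ℝ) :=
        one_div_le_one_div_of_le (by exact_mod_cast hn) (by exact_mod_cast hle)
      have hlow : 1 / ((k : ℝ) + 1) < u ↔ 0 < ((k : ℝ) + 1) * u + -1 := by
        rw [div_lt_iff₀ (by positivity)]
        constructor <;> intro <;> linarith
      have hupp : u ≤ 1 / (k : ℝ) ↔ ((k : ℝ) + 1) * u + -1 ≤ 1 / (k : ℝ) := by
        have h1 : ((k : ℝ) + 1) * (1 / k) = 1 + 1 / k := by field_simp
        constructor
        · intro h2
          have := mul_le_mul_of_nonneg_left h2 (by positivity : (0 : ℝ) ≤ k + 1)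
          linarith
        · intro h2
          refine le_of_mul_le_mul_left ?_ (by positivity : (0 : ℝ) < k + 1)
          linarith
      simp only [hB', Set.mem_inter_iff, Set.mem_ofPred_eq, Set.mem_Ioc, Set.mem_preimage]
      constructor
      · rintro ⟨⟨h1, h2⟩, h3, -⟩
        have := (floor_one_div_eq_iff h3 hk).1 h1
        exact ⟨h2, hlow.1 this.1, hupp.1 this.2⟩
      · rintro ⟨h1, h2, h3⟩
        have h2 := hlow.2 h2
        have h3 := hupp.2 h3
        have hu : 0 < u := lt_trans (by positivity) h2
        exact ⟨⟨(floor_one_div_eq_iff hu hk).2 ⟨h2, h3⟩, h1⟩, hu, h3.trans hnk⟩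
    rw [hset, hvol B' hB'm, hB'eq, Real.volume_preimage_mul_left (by positivity),
      measure_preimage_add_right, abs_of_pos (by positivity), ENNReal.ofReal_mul hs.le, mul_assoc]

theorem isEngelSequence_engelDigit :
    IsEngelSequence (volume.restrict (Set.Icc (0 : ℝ) 1)) (fun _ => uniformDistribution)
      engelDigit := by
  have hΘ : ∀ n x, engelDigit n x - 1 = ⌊1 / engelRemainder x (n - 1)⌋₊ := fun n x => by
    simp [engelDigit]
  have hmeas : ∀ n, Measurable fun x => ⌊1 / engelRemainder x (n - 1)⌋₊ := fun n =>
    Nat.measurable_floor.comp (measurable_const.div (measurable_engelRemainder _))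
  unfold IsEngelSequence
  simp only [hΘ]
  rw [← Measure.restrict_congr_set (Ioc_ae_eq_Icc (μ := (volume : Measure ℝ)) (a := 0) (b := 1))]
  refine ⟨fun n _ => hmeas n, fun n _ => ?_, fun n hn h hh1 hk hadm _ => ?_⟩
  · filter_upwards [ae_restrict_mem measurableSet_Ioc] with x hx
    obtain ⟨h0, h1⟩ := engelRemainder_mem hx (n - 1)
    exact Nat.le_floor (by rw [Nat.cast_one]; exact (one_le_div₀ h0).2 h1)
  -- The fictitious entry 1 at index 0 encodes that x itself is uniform on (0, 1].
  · obtain ⟨hh, s, hs, hvol⟩ := exists_volume_engel_cylinder (fun j => if j = 0 then 1 else h j)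
      rfl n (fun j hj => by
        rcases Nat.eq_zero_or_pos j with rfl | hj0
        · simpa using hh1
        · have := hadm (j + 1) (by omega) (by omega)
          simp only [Nat.add_sub_cancel, Nat.cast_le] at this
          simpa [hj0.ne'] using this)
    simp only [if_neg (show n ≠ 0 by omega), Nat.add_eq_zero_iff, one_ne_zero, and_false,
      if_false] at hh hvol
    set k := h (n + 1)
    have hk0 : (0 : ℝ) < (k : ℝ) := by exact_mod_cast hk
    have hn0 : (0 : ℝ) < (h n : ℝ) := by exact_mod_cast hh
    set E : Set ℝ := {ω | ∀ j, 1 ≤ j → j ≤ n → ⌊1 / engelRemainder ω (j - 1)⌋₊ = h j} with hE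
    have hEeq : ∀ x, x ∈ E ↔ ∀ j < n, ⌊1 / engelRemainder x j⌋₊ = h (j + 1) := fun x => by
      constructor
      · intro h' j hj
        exact h' (j + 1) (by omega) (by omega)
      · intro h' j hj hj'
        have := h' (j - 1) (by omega)
        rwa [Nat.sub_add_cancel hj] at this
    have hEm : MeasurableSet E := by
      have : E = ⋂ j, ⋂ (_ : 1 ≤ j), ⋂ (_ : j ≤ n),
          (fun x => ⌊1 / engelRemainder x (j - 1)⌋₊) ⁻¹' {h j} := by
        ext x; simp [hE]
      rw [this]
      exact MeasurableSet.iInter fun j => MeasurableSet.iInter fun _ => MeasurableSet.iInter fun _ =>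
        hmeas j (measurableSet_singleton _)
    have hPE : (volume.restrict (Set.Ioc (0 : ℝ) 1)) E = ENNReal.ofReal (s * (1 / h n)) := by
      rw [Measure.restrict_apply hEm, Set.inter_comm, ENNReal.ofReal_mul hs.le]
      have := hvol Set.univ MeasurableSet.univ
      rw [Set.univ_inter, Real.volume_Ioc, sub_zero] at this
      rw [← this]
      congr 2
      ext x
      simp [hEeq]
    have hB : MeasurableSet {u : ℝ | ⌊1 / u⌋₊ = k} :=
      (Nat.measurable_floor.comp (measurable_const.div measurable_id)) (measurableSet_singleton k)
    have hPEk : (volume.restrict (Set.Ioc (0 : ℝ) 1))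
        (E ∩ {ω | ⌊1 / engelRemainder ω (n + 1 - 1)⌋₊ = k}) =
        ENNReal.ofReal (s * (min (1 / (k : ℝ)) (1 / h n) - 1 / (k + 1))) := by
      have := hvol _ hB
      have hkm : MeasurableSet {ω | ⌊1 / engelRemainder ω (n + 1 - 1)⌋₊ = k} :=
        hmeas (n + 1) (measurableSet_singleton k)
      rw [Measure.restrict_apply (hEm.inter hkm), Set.inter_comm, ENNReal.ofReal_mul hs.le]
      have hint : {u : ℝ | ⌊1 / u⌋₊ = k} ∩ Set.Ioc 0 (1 / (h n : ℝ)) =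
          Set.Ioc (1 / ((k : ℝ) + 1)) (min (1 / (k : ℝ)) (1 / h n)) := by
        ext u
        simp only [Set.mem_inter_iff, Set.mem_ofPred_eq, Set.mem_Ioc, le_min_iff]
        constructor
        · rintro ⟨h1, h2, h3⟩
          have := (floor_one_div_eq_iff h2 hk).1 h1
          exact ⟨this.1, this.2, h3⟩
        · rintro ⟨h1, h2, h3⟩
          have hu : 0 < u := lt_trans (by positivity) h1
          exact ⟨(floor_one_div_eq_iff hu hk).2 ⟨h1, h2⟩, hu, h3⟩
      rw [hint, Real.volume_Ioc] at this
      rw [← this]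
      congr 2
      ext x
      simp [hEeq]
    rw [cond_apply hEm, hPE, hPEk, ← ENNReal.ofReal_inv_of_pos (by positivity),
      ← ENNReal.ofReal_mul (by positivity)]
    simp only [oppenheimDelta, mul_zero, add_zero, mul_one, Nat.cast_add, Nat.cast_one]
    change _ = ENNReal.ofReal (uniformDistribution ((h n : ℝ) / k) -
      uniformDistribution ((h n : ℝ) / ((k : ℝ) + 1)))
    have hsimp : (s * (1 / (h n : ℝ)))⁻¹ * (s * (min (1 / (k : ℝ)) (1 / h n) - 1 / (k + 1))) =
        h n * (min (1 / (k : ℝ)) (1 / h n) - 1 / (k + 1)) := by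
      field_simp
    rw [hsimp]
    -- The prescribed law also covers k < hₙ: there both values of F are 1, and the block misses (0,
    -- 1 / hₙ].
    rcases le_or_gt (h n) k with hle | hlt
    · have hle' : (h n : ℝ) ≤ k := by exact_mod_cast hle
      rw [min_eq_left (one_div_le_one_div_of_le hn0 hle'),
        uniformDistribution_of_mem (by positivity) ((div_le_one₀ hk0).2 hle'),
        uniformDistribution_of_mem (by positivity) ((div_le_one₀ (by positivity)).2 (by linarith))]
      congr 1
      ring
    · have hlt' : (k : ℝ) + 1 ≤ h n := by exact_mod_cast hlt
      have hU := isUnitDistribution_uniformDistribution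
      rw [hU.eq_one _ ((one_le_div₀ hk0).2 (by linarith)),
        hU.eq_one _ ((one_le_div₀ (by positivity)).2 hlt'), sub_self, ENNReal.ofReal_zero]
      refine ENNReal.ofReal_of_nonpos (mul_nonpos_of_nonneg_of_nonpos hn0.le ?_)
      have := one_div_le_one_div_of_le (by positivity) hlt'
      have := min_le_right (1 / (k : ℝ)) (1 / h n)
      linarith

theorem lintegral_uniformDistribution_eq_zero :
    ∫⁻ u in Set.Ioo 0 1, ENNReal.ofReal (1 / u * |uniformDistribution u / u - 1|) = 0 := by
  rw [setLIntegral_congr_fun (g := fun _ => 0) measurableSet_Ioo fun u hu => ?_, lintegral_zero]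
  have hu : 0 < u ∧ u < 1 := hu
  simp [uniformDistribution_of_mem hu.1.le hu.2.le, div_self hu.1.ne']

theorem tendstoInMeasure_engelDigit {a : ℕ → ℕ → ℝ} {ρ : ℕ → ℝ} {ℓ : ℝ}
    (hW : WeightAssumptions (fun _ => 1) a ρ ℓ) {A : ℝ}
    (hA : ∀ n k, 1 ≤ k → k ≤ n → a k n ≤ A) :
    TendstoInMeasure (volume.restrict (Set.Icc (0 : ℝ) 1))
      (fun (n : ℕ) (x : ℝ) => 1 / (ρ n * Real.log n) *
        ∑ k ∈ Finset.Icc 1 n, a k n * ((engelDigit (k + 1) x : ℝ) / (engelDigit k x : ℝ)))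
      atTop (fun _ => ℓ) := by
  have hP : IsProbabilityMeasure ((volume : Measure ℝ).restrict (Set.Icc (0 : ℝ) 1)) :=
    ⟨by simp⟩
  have hU := isUnitDistribution_uniformDistribution
  refine isEngelSequence_engelDigit.tendstoInMeasure_of_uniform_bounds (fun _ _ => hU) hW hA
    one_pos (fun _ _ => le_rfl) (fun _ _ => le_rfl) (p := 1 / 2) (C := 1) (K := 1 + 0)
    (by norm_num) ?_ ?_ ?_
  · intro _ _
    exact (uniformDistribution_of_mem (by norm_num) (by norm_num)).ge
  · intro _ _ t ht
    rw [one_mul, uniformDistribution_apply]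
    exact max_le ht.le (min_le_left _ _)
  · intro _ _ s hs hs1
    exact hU.abs_integral_inv_max_sub_log_le le_rfl
      (lintegral_uniformDistribution_eq_zero.trans_le zero_le) hs hs1

/-- The first part concerns the digits of the Engel series of a Lebesgue-random point of `[0, 1]`
(all `Fₙ` uniform, `αₙ = 1`), the second one the Engel scheme with general `Fₙ`. -/
theorem mainTheorem9 (a : ℕ → ℕ → ℝ) (ρ : ℕ → ℝ) (ℓ : ℝ)
    (ha : BddAbove {y : ℝ | ∃ n k : ℕ, 1 ≤ k ∧ k ≤ n ∧ y = a k n}) :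
    (WeightAssumptions (fun _ => 1) a ρ ℓ →
      TendstoInMeasure (volume.restrict (Set.Icc (0 : ℝ) 1))
        (fun (n : ℕ) (x : ℝ) => 1 / (ρ n * Real.log n) *
          ∑ k ∈ Finset.Icc 1 n, a k n * ((engelDigit (k + 1) x : ℝ) / (engelDigit k x : ℝ)))
        atTop (fun _ => ℓ)) ∧
    (∀ (F : ℕ → StieltjesFunction ℝ) (α : ℕ → ℝ),
      (∀ n, 1 ≤ n → IsUnitDistribution (F n)) → ConditionI F α → ConditionII F α →
      WeightAssumptions α a ρ ℓ →
      ∀ (Ω : Type*) [MeasurableSpace Ω] (P : Measure Ω) [IsProbabilityMeasure P]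
        (D : ℕ → Ω → ℕ), IsEngelSequence P F D →
        TendstoInMeasure P
          (fun (n : ℕ) (ω : Ω) => 1 / (ρ n * Real.log n) *
            ∑ k ∈ Finset.Icc 1 n, a k n * ((D (k + 1) ω : ℝ) / (D k ω : ℝ)))
          atTop (fun _ => ℓ)) := by
  obtain ⟨A, hA⟩ := ha
  have hA : ∀ n k, 1 ≤ k → k ≤ n → a k n ≤ A := fun n k hk hkn => hA ⟨n, k, hk, hkn, rfl⟩
  exact ⟨fun hW => tendstoInMeasure_engelDigit hW hA,
    fun F α hF hI hII hW Ω _ P _ D hD => hD.tendstoInMeasure hF hI hII hW hA⟩
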